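/- **Pushdown systems of level 2.** Let $\mathcal N=(Q,\Sigma,\Delta,q_0)$ be a $2$-PS: $Q$ is a finite set of states, $q_0\in Q$, $\Sigma$ is a finite alphabet with a distinguished letter $\bot$, and $\Delta\subseteq Q\times\Sigma\times Q\times \mathrm{Op}$ with $\mathrm{Op}=\{\mathrm{push}_\sigma:\sigma\in\Sigma\setminus\{\bot\}\}\cup\{\mathrm{pop}_1,\mathrm{clone}_2,\mathrm{pop}_2\}$. A ($2$-)stack is a nonempty sequence $s=w_1:\dots:w_m$ of nonempty words over $\Sigma$; its width is $|s|=m$, its height is $\mathrm{hgt}(s)=\max_i|w_i|$, its topmost word is $\mathrm{top}_2(s)=w_m$, and $\mathrm{top}_1(s)$ is the last letter of $w_m$. $\mathrm{push}_\sigma$ appends $\sigma$ to $w_m$, $\mathrm{pop}_1$ deletes the last letter of $w_m$ (undefined if $|w_m|=1$), $\mathrm{clone}_2$ appends a copy of $w_m$ to the sequence, and $\mathrm{pop}_2$ deletes $w_m$ (undefined if $m=1$). A configuration is a pair $(q,s)$ of a state and a stack; there is a transition from $(q,s)$ to $(q',t)$ if $(q,\mathrm{top}_1(s),q',\mathrm{op})\in\Delta$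 and $\mathrm{op}(s)=t$ for some $\mathrm{op}$. A run is a finite nonempty sequence of configurations connected by transitions. The initial configuration is $(q_0,[\bot])$. For a run $\rho$ ending in $(q,s)$ write $\mathrm{top}_2(\rho)=\mathrm{top}_2(s)$, $\mathrm{hgt}(\rho)=\mathrm{hgt}(s)$, $|\rho|=|s|$. **Loops and returns.** For a word $w$ and a sequence $t$ of words, a loop of $t:w$ is a run from $(q,t:w)$ to $(q',t:w)$, for some $q,q'\in Q$, that does not pass the stack $t$; it is a high loop if it does not pass $\mathrm{pop}_1(t:w)$ either. If $t\neq\emptyset$, a return of $t:w$ is a run from $(q,t:w)$ to $(q',t)$ that visits $t$ only in its final configuration. The number of these runs for given $q,q'$ does not depend on $t$ (provided $t\ne\emptyset$ in the case of returns). Let $\mathrm{Loop}^z(w),\mathrm{HLoop}^z(w),\mathrm{Ret}^z(w):Q\times Q\to\{0,\dots,z\}$ map $(q,q')$ to the number of loops, high loops and returns, respectively, of $t:w$ from $q$ to $q'$, counted up to threshold $z$ (i.e. replaced by $z$ if larger than $z$ or infinite). **Equivalence of words.** For $w\in\Sigma^*$ and $0\le i<|w|$ let $w_{-i}$ be $w$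 without its last $i$ letters. For $k,z\in\mathbb N$, let $\mathrm{Lin}^0_{k;z}(w)$ be the structure with domain $\{0,\dots,|w|-1\}$, the usual successor relation, and unary predicates telling for each $i$ the last letter of $w_{-i}$, for all $q,q'\in Q$ and $j\le z$ whether there are $j$ pairwise distinct runs from $(q,[w])$ to $(q',[w_{-i}])$, and the functions $\mathrm{Ret}^z(w_{-i})$, $\mathrm{Loop}^z(w_{-i})$, $\mathrm{HLoop}^z(w_{-i})$. Let $\mathrm{Typ}^n_{k;z}(w)$ be the set of first-order sentences of quantifier rank at most $k$ that hold in $\mathrm{Lin}^n_{k;z}(w)$, and let $\mathrm{Lin}^{n+1}_{k;z}(w)$ be the expansion of $\mathrm{Lin}^n_{k;z}(w)$ by one unary predicate for each set $\theta$ of the form $\mathrm{Typ}^n_{k;z}(v)$ with $v\in\Sigma^*$, which holds at $i$ if and only if $\mathrm{Typ}^n_{k;z}(w_{-i})=\theta$. Write $w\equiv^n_z w'$ if $\mathrm{Typ}^n_{z;z}(w)=\mathrm{Typ}^n_{z;z}(w')$. **Statement.** Let $n\in\mathbb N$ and $z\ge 2$. The relations $\equiv^n_z$ and $\equiv^0_2$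 have only finitely many classes on $\Sigma^*$, so that $$C(n,z)=|Q|\cdot|\Sigma^*/{\equiv^n_z}|+1,\qquad H=|\Sigma^*/{\equiv^0_2}|\cdot|Q|^2,\qquad W(h)=|Q|\cdot(|\Sigma|+1)^h$$ are natural numbers. For every run $\rho$ from the initial configuration to some configuration $(q,s)$ there is a run $\rho'$ starting in the initial configuration such that $$|\mathrm{top}_2(\rho)|-C(n,z)\le|\mathrm{top}_2(\rho')|\le|\mathrm{top}_2(\rho)|,$$ $$\mathrm{hgt}(\rho')\le|\mathrm{top}_2(\rho')|+H,\qquad |\rho'|\le W(\mathrm{hgt}(\rho')),\qquad \mathrm{top}_2(\rho)\equiv^n_z\mathrm{top}_2(\rho').$$ Furthermore, if $|\mathrm{top}_2(\rho)|>C(n,z)$, then $|\mathrm{top}_2(\rho')|<|\mathrm{top}_2(\rho)|$. -/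

import Mathlib

universe u v

/-!  Words and level-2 stacks.

A word over `A` is a `List A` whose *head is the topmost letter*, and a level-2 stack over `A` is a
list of words whose *head is the topmost word*.  Thus the words `w.drop i` (`i < w.length`) are the
nonempty prefixes of `w` in the usual reading from bottom to top, and `w.drop i` is obtained from `w`
by `i`-fold application of `pop₁`. -/

/-- Level-2 stacks over `A`: nonempty lists of nonempty words. -/
def IsStack {A : Type v} (s : List (List A)) : Prop :=
  s ≠ [] ∧ ∀ w ∈ s, w ≠ []

/-- The topmost word of a stack. -/
def topWord {A : Type v} (s : List (List A)) : List A := s.headD []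

/-- The topmost letter of a stack. -/
def topLetter {A : Type v} (s : List (List A)) : Option A := (topWord s).head?

/-- The width of a stack: the number of its words. -/
def stackWidth {A : Type v} (s : List (List A)) : ℕ := s.length

/-- The height of a stack: the maximal length of its words. -/
def stackHeight {A : Type v} (s : List (List A)) : ℕ := (s.map List.length).foldr max 0

/-- The level-2 stack operations over an alphabet with bottom-of-stack symbol `bot`. -/
inductive StackOp {A : Type v} (bot : A) : Type v
  | push (a : A) (ha : a ≠ bot) : StackOp bot
  | pop₁ : StackOp bot
  | clone₂ : StackOp bot
  | pop₂ : StackOp bot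

/-- The partial functions on stacks denoted by the operations (`none` means undefined).  A pop that
would remove the last letter of the topmost word, or the last word of the stack, is undefined. -/
def StackOp.apply {A : Type v} {bot : A} : StackOp bot → List (List A) → Option (List (List A))
  | .push a _, w :: s => some ((a :: w) :: s)
  | .pop₁, (_ :: b :: w) :: s => some ((b :: w) :: s)
  | .clone₂, w :: s => some (w :: w :: s)
  | .pop₂, _ :: w :: s => some (w :: s)
  | _, _ => none

/-- The stack operations map stacks to stacks. -/
theorem StackOp.isStack_apply {A : Type v} {bot : A} (op : StackOp bot) (s t : List (List A))
    (hs : IsStack s) (h : op.apply s = some t) : IsStack t := by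
  obtain ⟨_, h2⟩ := hs
  unfold StackOp.apply at h
  split at h <;> simp_all [IsStack] <;> subst h <;> simp_all

/-- Pushdown systems of level 2 with set of states `Q` and stack alphabet `A`. -/
structure PDS₂ (Q : Type u) (A : Type v) where
  /-- the bottom-of-stack symbol -/
  bot : A
  /-- the initial state -/
  init : Q
  /-- the transition relation -/
  Δ : Set (Q × A × Q × StackOp bot)

namespace PDS₂

variable {Q : Type u} {A : Type v}

/-- The one-step relation on configurations (pairs of a state and a stack). -/
def Step (N : PDS₂ Q A) (c d : Q × List (List A)) : Prop :=
  ∃ (a : A) (op : StackOp N.bot),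
    (c.1, a, d.1, op) ∈ N.Δ ∧ topLetter c.2 = some a ∧ op.apply c.2 = some d.2

/-- The initial configuration: the initial state, with a single word consisting of the
bottom-of-stack symbol. -/
def initConf (N : PDS₂ Q A) : Q × List (List A) := (N.init, [[N.bot]])

/-- `ρ` is a run from `c` to `d`: a finite sequence of configurations, in chronological order,
consecutive ones being connected by transitions.  (The transition used in each step is determined
by the sequence of configurations.) -/
def IsRun (N : PDS₂ Q A) (ρ : List (Q × List (List A))) (c d : Q × List (List A)) : Prop :=
  ρ.IsChain N.Step ∧ ρ.head? = some c ∧ ρ.getLast? = some d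

/-- Runs between the single-word stacks `[w]` and `[v]`. -/
def wordRuns (N : PDS₂ Q A) (w v : List A) (q q' : Q) : Set (List (Q × List (List A))) :=
  {ρ | N.IsRun ρ (q, [w]) (q', [v])}

/-- Loops of the stack `w :: t` with topmost word `w`: runs from `w :: t` to itself that do not
pass `t`. -/
def loops (N : PDS₂ Q A) (w : List A) (t : List (List A)) (q q' : Q) :
    Set (List (Q × List (List A))) :=
  {ρ | N.IsRun ρ (q, w :: t) (q', w :: t) ∧ ∀ c ∈ ρ, c.2 ≠ t}

/-- High loops of `w :: t`: loops that do not pass the stack `pop₁ (w :: t)` either. -/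
def highLoops (N : PDS₂ Q A) (w : List A) (t : List (List A)) (q q' : Q) :
    Set (List (Q × List (List A))) :=
  {ρ | ρ ∈ N.loops w t q q' ∧ ∀ c ∈ ρ, c.2 ≠ w.tail :: t}

/-- Returns of `w :: t`: runs from `w :: t` to `t` that visit `t` only in their final
configuration. -/
def returns (N : PDS₂ Q A) (w : List A) (t : List (List A)) (q q' : Q) :
    Set (List (Q × List (List A))) :=
  {ρ | N.IsRun ρ (q, w :: t) (q', t) ∧ ∀ c ∈ ρ.dropLast, c.2 ≠ t}

/-- The number of elements of a set, counted up to threshold `k`. -/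
noncomputable def countUpTo {X : Type*} (k : ℕ) (S : Set X) : Fin (k + 1) :=
  ⟨(min (k : ℕ∞) S.encard).toNat, Nat.lt_succ_of_le
    (ENat.toNat_le_of_le_natCast (min_le_left _ _))⟩

/-- Loops of the word `w` counted up to threshold `k` (the stack below `w` is irrelevant). -/
noncomputable def loopFunc (N : PDS₂ Q A) (k : ℕ) (w : List A) : Q × Q → Fin (k + 1) :=
  fun p => countUpTo k (N.loops w [] p.1 p.2)

/-- High loops of the word `w` counted up to threshold `k` (the stack below `w` is irrelevant). -/
noncomputable def highLoopFunc (N : PDS₂ Q A) (k : ℕ) (w : List A) : Q × Q → Fin (k + 1) :=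
  fun p => countUpTo k (N.highLoops w [] p.1 p.2)

/-- Returns of the word `w` counted up to threshold `k` (the stack below `w` is irrelevant, as long
as it is nonempty). -/
noncomputable def returnFunc (N : PDS₂ Q A) (k : ℕ) (w : List A) : Q × Q → Fin (k + 1) :=
  fun p => countUpTo k (N.returns w [[N.bot]] p.1 p.2)

end PDS₂

/-! First-order logic over coloured finite successor structures. -/

/-- The quantifier rank: the maximal nesting depth of quantifiers. -/
def quantRank {L : FirstOrder.Language.{u, v}} {α : Type*} : {n : ℕ} → L.BoundedFormula α n → ℕ
  | _, .falsum => 0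
  | _, .equal _ _ => 0
  | _, .rel _ _ => 0
  | _, .imp φ ψ => max (quantRank φ) (quantRank ψ)
  | _, .all φ => quantRank φ + 1

/-- Relation symbols: the binary successor relation and a unary predicate for each colour. -/
inductive SuccRel (C : Type u) : ℕ → Type u
  | succ : SuccRel C 2
  | color (c : C) : SuccRel C 1

/-- The relational language of successor structures with colours from `C`. -/
def succLanguage (C : Type u) : FirstOrder.Language.{0, u} := ⟨fun _ => Empty, SuccRel C⟩

/-- The structure on `{0, …, m - 1}` with the usual successor relation, in which the elements of
colour `c` are those satisfying `P c`. -/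
@[reducible]
def succStructure {C : Type u} (P : C → ℕ → Prop) (m : ℕ) : (succLanguage C).Structure (Fin m) where
  funMap := fun f _ => Empty.elim f
  RelMap := fun r x => match r, x with
    | .succ, x => (x 1 : ℕ) = (x 0 : ℕ) + 1
    | .color c, x => P c (x 0)

/-- The theory of quantifier rank `k` of a structure. -/
def rankTheory (L : FirstOrder.Language.{u, v}) (M : Type*) (inst : L.Structure M) (k : ℕ) :
    Set L.Sentence :=
  {φ | quantRank φ ≤ k ∧ @FirstOrder.Language.Sentence.Realize L M inst φ}

/-- A uniform expansion of the (reversed) word models of all words over `A`: a set of colours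
and, for each word `w`, the set of positions of `w` that carry a given colour. -/
structure WordExpansion (A : Type v) : Type (max (u + 1) v) where
  Color : Type u
  HasColor : Color → List A → ℕ → Prop

/-- The theory of quantifier rank `k` of the expanded word model of `w`, with domain
`{0, …, |w| - 1}`. -/
def WordExpansion.typ {A : Type v} (E : WordExpansion.{u} A) (k : ℕ) (w : List A) :
    Set (succLanguage E.Color).Sentence :=
  rankTheory (succLanguage E.Color) (Fin w.length)
    (succStructure (fun c i => E.HasColor c w i) w.length) k

/-- The further expansion by one predicate for each realised type of quantifier rank `k`, marking
the positions `i` for which the prefix `w.drop i` has this type. -/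
def WordExpansion.next {A : Type v} (E : WordExpansion.{max u v} A) (k : ℕ) :
    WordExpansion.{max u v} A where
  Color := E.Color ⊕ Set.range (E.typ k)
  HasColor := fun c w i => match c with
    | .inl c => E.HasColor c w i
    | .inr θ => E.typ k (w.drop i) = θ.1

/-- The predicates of the expanded word models of level `0`. -/
inductive BaseColor (Q : Type u) (A : Type v) (z : ℕ) : Type (max u v)
  | letter (a : A)
  | runs (q q' : Q) (j : Fin (z + 1))
  | ret (f : Q × Q → Fin (z + 1))
  | loop (f : Q × Q → Fin (z + 1))
  | highLoop (f : Q × Q → Fin (z + 1))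

namespace PDS₂

variable {Q : Type u} {A : Type v}

/-- The expanded word models of level `0`, with counting threshold `z`.  Position `i` of `w`
represents the prefix `w.drop i`; it carries its topmost letter, for each `q`, `q'`, `j` the
information whether there are `j` pairwise distinct runs from `(q, w)` to `(q', w.drop i)`, and the
numbers of returns, loops and high loops of `w.drop i` up to threshold `z`. -/
def baseExpansion (N : PDS₂ Q A) (z : ℕ) : WordExpansion.{max u v} A where
  Color := BaseColor Q A z
  HasColor := fun c w i => match c with
    | .letter a => (w.drop i).head? = some a
    | .runs q q' j => ((j : ℕ) : ℕ∞) ≤ (N.wordRuns w (w.drop i) q q').encard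
    | .ret f => N.returnFunc z (w.drop i) = f
    | .loop f => N.loopFunc z (w.drop i) = f
    | .highLoop f => N.highLoopFunc z (w.drop i) = f

/-- The expanded word models of level `n`, with quantifier rank `k` and counting threshold `z`. -/
def lin (N : PDS₂ Q A) (k z : ℕ) : ℕ → WordExpansion.{max u v} A
  | 0 => N.baseExpansion z
  | n + 1 => (lin N k z n).next k

/-- Equivalence of words of level `n` with parameter `z`: the expanded word models of level `n`
(with `k = z`) have the same theory of quantifier rank `z`. -/
def wordSetoid (N : PDS₂ Q A) (n z : ℕ) : Setoid (List A) :=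
  Setoid.ker ((N.lin z z n).typ z)

/-- Equivalence of words, as a relation. -/
def WordEquiv (N : PDS₂ Q A) (n z : ℕ) (w w' : List A) : Prop := N.wordSetoid n z w w'

/-- The set of equivalence classes of words. -/
abbrev WordClasses (N : PDS₂ Q A) (n z : ℕ) : Type v := Quotient (N.wordSetoid n z)

/-- The bound for the length of the topmost word. -/
noncomputable def boundTopWord (N : PDS₂ Q A) (n z : ℕ) : ℕ :=
  Nat.card Q * Nat.card (N.WordClasses n z) + 1

/-- The bound for the difference of the height and the length of the topmost word. -/
noncomputable def boundHeight (N : PDS₂ Q A) : ℕ :=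
  Nat.card (N.WordClasses 0 2) * Nat.card Q ^ 2

/-- The bound for the width of a stack of height `h`. -/
noncomputable def boundWidth (_N : PDS₂ Q A) (h : ℕ) : ℕ :=
  Nat.card Q * (Nat.card A + 1) ^ h

end PDS₂

/-!
Contracting every return of a copy of the topmost word to a single step turns the runs of a level-2
system into walks on single words, in which a cloning operation whose copy is never removed leaves
the word unchanged and stores it in the stack below (`PDS₂.Good`, `PDS₂.good_iff`).  In such a walk
the lower part `v` of a word `x ++ v` influences the part above it only by the returns of `v` and by
its topmost letter.

*Top word.*  Each suffix `v` of the topmost word is visited for a last time, in some state.  If the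
topmost word is longer than the bound, two of the suffixes near its top are equivalent and belong to
the same state, and replacing the longer by the shorter one gives a shorter topmost word
(`PDS₂.Ladder.exists_shorter`).

*Height.*  The walk to `w` is a sequence of push operations that build `w`, interleaved with walks
above the suffixes of `w`.  The pairs of states joined by a walk of relative height `h` above `v`
depend only on the class of `v`, grow with `h`, and are computed from those for `h - 1` above the
words `a :: v`; so they are constant from `h = |Q|² · |classes|` on (`PDS₂.Hill.boundHeight`).

*Width.*  In a stack that is too wide two equal words have last been topmost in the same state, and
what lies between them can be left out (`PDS₂.Good.exists_narrower`).

For the first two arguments the equivalence of words must be a congruence for putting letters on top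
(`PDS₂.WordEquiv.append`).  There are two ingredients.  The numbers of returns, loops, high loops and
runs of `a :: v` up to a threshold are given by those of `v`
(`PDS₂.leUpTo_encard_valid_append`, `PDS₂.leUpTo_encard_valid_cons_end`): runs correspond to
derivation trees of an unambiguous grammar, and counting up to a threshold is compatible with sums,
products and increasing unions.  Moreover, an Ehrenfeucht–Fraïssé argument shows that a new least
element preserves the equivalence of successor structures of a given quantifier rank
(`RankEquiv.cons_least`).
-/

/-! ### Derivation trees of runs -/

/-- Derivation trees of runs that start in a stack `w :: t` and stay above `t`, stripped of all the
words.  Each tree records the operations and the states reached by them; `clone p r s₁ s₂` stands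
for cloning `w` (reaching `p`), a return `s₁` of the copy to state `r`, and a continuation `s₂`. -/
inductive RunTree (Q : Type u) (A : Type v) : Type (max u v)
  | leaf : RunTree Q A
  | push (a : A) (p : Q) (s : RunTree Q A) : RunTree Q A
  | pop (p : Q) (s : RunTree Q A) : RunTree Q A
  | clone (p r : Q) (s₁ s₂ : RunTree Q A) : RunTree Q A

namespace PDS₂

variable {Q : Type u} {A : Type v}

/-- The operation `op` is enabled in state `q` if the topmost word is `w`, and leads to `p`. -/
def Enabled (N : PDS₂ Q A) (q : Q) (w : List A) (p : Q) (op : StackOp N.bot) : Prop :=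
  ∃ a, w.head? = some a ∧ (q, a, p, op) ∈ N.Δ

theorem enabled_congr (N : PDS₂ Q A) {w w' : List A} (h : w.head? = w'.head?) (q p : Q)
    (op : StackOp N.bot) : N.Enabled q w p op ↔ N.Enabled q w' p op := by
  simp [Enabled, h]

theorem step_iff (N : PDS₂ Q A) (q : Q) (w : List A) (t : List (List A))
    (d : Q × List (List A)) :
    N.Step (q, w :: t) d ↔
      (∃ a h, N.Enabled q w d.1 (.push a h) ∧ d.2 = (a :: w) :: t) ∨
      (w.tail ≠ [] ∧ N.Enabled q w d.1 .pop₁ ∧ d.2 = w.tail :: t) ∨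
      (N.Enabled q w d.1 .clone₂ ∧ d.2 = w :: w :: t) ∨
      (t ≠ [] ∧ N.Enabled q w d.1 .pop₂ ∧ d.2 = t) := by
  obtain ⟨p, s⟩ := d
  constructor
  · rintro ⟨a, op, h1, h2, h3⟩
    have h2' : w.head? = some a := by simpa [topLetter, topWord] using h2
    cases op with
    | push b hb => exact .inl ⟨b, hb, ⟨a, h2', h1⟩, by simpa [StackOp.apply, eq_comm] using h3⟩
    | pop₁ =>
      refine .inr (.inl ?_)
      match w, h2', h3 with
      | _ :: b :: w, h2', h3 =>
        exact ⟨by simp, ⟨a, h2', h1⟩, by simpa [StackOp.apply, eq_comm] using h3⟩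
    | clone₂ =>
      exact .inr (.inr (.inl ⟨⟨a, h2', h1⟩, by simpa [StackOp.apply, eq_comm] using h3⟩))
    | pop₂ =>
      refine .inr (.inr (.inr ?_))
      match t, h3 with
      | _ :: t, h3 => exact ⟨by simp, ⟨a, h2', h1⟩, by simpa [StackOp.apply, eq_comm] using h3⟩
  · rintro (⟨b, hb, ⟨a, h2, h1⟩, h3⟩ | ⟨h4, ⟨a, h2, h1⟩, h3⟩ | ⟨⟨a, h2, h1⟩, h3⟩ |
      ⟨h4, ⟨a, h2, h1⟩, h3⟩)
    · exact ⟨a, _, h1, by simpa [topLetter, topWord], by simp_all [StackOp.apply]⟩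
    · refine ⟨a, _, h1, by simpa [topLetter, topWord], ?_⟩
      match w, h4 with
      | _ :: b :: w, _ => simp_all [StackOp.apply]
    · exact ⟨a, _, h1, by simpa [topLetter, topWord], by simp_all [StackOp.apply]⟩
    · refine ⟨a, _, h1, by simpa [topLetter, topWord], ?_⟩
      match t, h4 with
      | _ :: t, _ => simp_all [StackOp.apply]

/-- The end condition of a return to state `r`: the operation `pop₂` leads to `r`. -/
def RetEnd (N : PDS₂ Q A) (r : Q) : List A → Q → Prop := fun w q => N.Enabled q w r .pop₂

/-- The end condition of a run to the word `w'` and the state `q'`. -/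
def WordEnd (w' : List A) (q' : Q) : List A → Q → Prop := fun w q => w = w' ∧ q = q'

/-- The tree `s` describes a run from `w :: t` in state `q` that stays above `t`, whose last
configuration `(q', w' :: t)` satisfies the end condition `E w' q'`, and that does not visit
`u :: t` for `u ∈ B`. -/
def Valid (N : PDS₂ Q A) :
    RunTree Q A → (List A → Q → Prop) → Set (List A) → List A → Q → Prop
  | .leaf, E, B, w, q => w ∉ B ∧ E w q
  | .push a p s, E, B, w, q =>
      (w ∉ B ∧ ∃ h, N.Enabled q w p (.push a h)) ∧ Valid N s E B (a :: w) p
  | .pop p s, E, B, w, q => (w ∉ B ∧ w.tail ≠ [] ∧ N.Enabled q w p .pop₁) ∧ Valid N s E B w.tail p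
  | .clone p r s₁ s₂, E, B, w, q =>
      (w ∉ B ∧ N.Enabled q w p .clone₂) ∧ Valid N s₁ (N.RetEnd r) ∅ w p ∧ Valid N s₂ E B w r

/-- The run from `(q, w :: t)` described by a tree. -/
def toRun : RunTree Q A → Q → List A → List (List A) → List (Q × List (List A))
  | .leaf, q, w, t => [(q, w :: t)]
  | .push a p s, q, w, t => (q, w :: t) :: toRun s p (a :: w) t
  | .pop p s, q, w, t => (q, w :: t) :: toRun s p w.tail t
  | .clone p r s₁ s₂, q, w, t => (q, w :: t) :: (toRun s₁ p w (w :: t) ++ toRun s₂ r w t)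

theorem exists_toRun_eq_cons (s : RunTree Q A) (q : Q) (w : List A) (t : List (List A)) :
    ∃ l, toRun s q w t = (q, w :: t) :: l := by
  cases s <;> simp [toRun]

theorem exists_stack_eq_append_of_mem_toRun (s : RunTree Q A) :
    ∀ (q : Q) (w : List A) (t : List (List A)), ∀ c ∈ toRun s q w t, ∃ y ≠ [], c.2 = y ++ t := by
  induction s with
  | leaf => intro q w t c hc; simp only [toRun, List.mem_singleton] at hc; exact ⟨[w], by simp [hc]⟩
  | push a p s ih | pop p s ih =>
    intro q w t c hc
    rcases List.mem_cons.1 hc with rfl | hc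
    · exact ⟨[w], by simp⟩
    · exact ih _ _ _ _ hc
  | clone p r s₁ s₂ ih₁ ih₂ =>
    intro q w t c hc
    rcases List.mem_cons.1 hc with rfl | hc
    · exact ⟨[w], by simp⟩
    · rcases List.mem_append.1 hc with hc | hc
      · obtain ⟨y, -, hy⟩ := ih₁ _ _ _ _ hc
        exact ⟨y ++ [w], by simp, by simp [hy]⟩
      · exact ih₂ _ _ _ _ hc

/-- The tree of a run that stays above `t` is unique, as the return after a cloning operation ends
immediately before the first visit to the original stack. -/
theorem toRun_injective (s : RunTree Q A) :
    ∀ (s' : RunTree Q A) (q : Q) (w : List A) (t : List (List A)),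
      toRun s q w t = toRun s' q w t → s = s' := by
  have key : ∀ (s₁ s₁' s₂ s₂' : RunTree Q A) (p p' r r' : Q) (w : List A) (t : List (List A)),
      toRun s₁ p w (w :: t) ++ toRun s₂ r w t = toRun s₁' p' w (w :: t) ++ toRun s₂' r' w t →
      toRun s₁ p w (w :: t) = toRun s₁' p' w (w :: t) ∧ toRun s₂ r w t = toRun s₂' r' w t := by
    intro s₁ s₁' s₂ s₂' p p' r r' w t h
    have h0 : ∀ (s : RunTree Q A) (p : Q), ∀ c ∈ toRun s p w (w :: t), c.2 ≠ w :: t := by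
      intro s p c hc e
      obtain ⟨y, hy, h⟩ := exists_stack_eq_append_of_mem_toRun s _ _ _ c hc
      rw [e] at h
      have := congrArg List.length h
      simp at this
      exact hy this
    rcases List.append_eq_append_iff.1 h with ⟨l, h1, h2⟩ | ⟨l, h1, h2⟩
    · cases l with
      | nil => simp_all
      | cons c l =>
        obtain ⟨m, hm⟩ := exists_toRun_eq_cons s₂ r w t
        rw [hm] at h2
        have hc : c = (r, w :: t) := by simp at h2; exact h2.1.symm
        exact absurd (by rw [hc]) (h0 s₁' p' c (by rw [h1]; simp))
    · cases l with
      | nil => simp_all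
      | cons c l =>
        obtain ⟨m, hm⟩ := exists_toRun_eq_cons s₂' r' w t
        rw [hm] at h2
        have hc : c = (r', w :: t) := by simp at h2; exact h2.1.symm
        exact absurd (by rw [hc]) (h0 s₁ p c (by rw [h1]; simp))
  have head : ∀ (s s' : RunTree Q A) (p p' : Q) (w w' : List A) (t t' : List (List A)) l l',
      toRun s p w t ++ l = toRun s' p' w' t' ++ l' → p = p' ∧ w :: t = w' :: t' := by
    intro s s' p p' w w' t t' l l' h
    obtain ⟨m, hm⟩ := exists_toRun_eq_cons s p w t
    obtain ⟨m', hm'⟩ := exists_toRun_eq_cons s' p' w' t'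
    rw [hm, hm'] at h
    simp at h
    simpa using h.1
  have nn : ∀ (s : RunTree Q A) (p : Q) (w : List A) (t : List (List A)), toRun s p w t ≠ [] := by
    intro s p w t
    obtain ⟨m, hm⟩ := exists_toRun_eq_cons s p w t
    simp [hm]
  have tl : ∀ (a : A) (w : List A), a :: w ≠ w.tail := fun a w e => by
    have := congrArg List.length e
    simp at this
    omega
  have cl : ∀ (w w' : List A) (t : List (List A)), w :: w :: t ≠ w' :: t := fun w w' t e => by
    have := congrArg List.length e
    simp at this
  induction s with
  | leaf =>
    intro s' q w t h
    cases s' with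
    | leaf => rfl
    | push | pop => exact absurd (List.cons.inj h).2.symm (nn _ _ _ _)
    | clone =>
      have := (List.append_eq_nil_iff.1 (List.cons.inj h).2.symm).1
      exact absurd this (nn _ _ _ _)
  | push a p s ih =>
    intro s' q w t h
    cases s' with
    | leaf => simp [toRun, nn] at h
    | push b p' s' =>
      simp only [toRun, List.cons.injEq, true_and] at h
      have h2 := head _ _ _ _ _ _ _ _ [] [] (by simpa using h)
      simp only [List.cons.injEq, and_true] at h2
      obtain ⟨rfl, rfl⟩ := h2
      rw [ih _ _ _ _ h]
    | pop p' s' =>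
      simp only [toRun, List.cons.injEq, true_and] at h
      have h2 := head _ _ _ _ _ _ _ _ [] [] (by simpa using h)
      simp [tl] at h2
    | clone p' r' s₁' s₂' =>
      simp only [toRun, List.cons.injEq, true_and] at h
      have h2 := head _ _ _ _ _ _ _ _ [] _ (by simpa using h)
      exact absurd h2.2.symm (cl _ _ _)
  | pop p s ih =>
    intro s' q w t h
    cases s' with
    | leaf => simp [toRun, nn] at h
    | pop p' s' =>
      simp only [toRun, List.cons.injEq, true_and] at h
      have h2 := head _ _ _ _ _ _ _ _ [] [] (by simpa using h)
      obtain ⟨rfl, -⟩ := h2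
      rw [ih _ _ _ _ h]
    | push b p' s' =>
      simp only [toRun, List.cons.injEq, true_and] at h
      have h2 := head _ _ _ _ _ _ _ _ [] [] (by simpa using h)
      simp [(tl _ _).symm] at h2
    | clone p' r' s₁' s₂' =>
      simp only [toRun, List.cons.injEq, true_and] at h
      have h2 := head _ _ _ _ _ _ _ _ [] _ (by simpa using h)
      exact absurd h2.2.symm (cl _ _ _)
  | clone p r s₁ s₂ ih₁ ih₂ =>
    intro s' q w t h
    cases s' with
    | leaf => simp [toRun, nn] at h
    | pop p' s' =>
      simp only [toRun, List.cons.injEq, true_and] at h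
      have h2 := head _ _ _ _ _ _ _ _ _ [] (by simpa using h)
      exact absurd h2.2 (cl _ _ _)
    | push b p' s' =>
      simp only [toRun, List.cons.injEq, true_and] at h
      have h2 := head _ _ _ _ _ _ _ _ _ [] (by simpa using h)
      exact absurd h2.2 (cl _ _ _)
    | clone p' r' s₁' s₂' =>
      simp only [toRun, List.cons.injEq, true_and] at h
      obtain ⟨h1, h2⟩ := key _ _ _ _ _ _ _ _ _ _ h
      obtain ⟨rfl, -⟩ := head _ _ _ _ _ _ _ _ [] [] (by simpa using h1)
      obtain ⟨rfl, -⟩ := head _ _ _ _ _ _ _ _ [] [] (by simpa using h2)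
      rw [ih₁ _ _ _ _ h1, ih₂ _ _ _ _ h2]

/-- Valid trees describe runs as required by `Valid`. -/
theorem Valid.toRun_spec {N : PDS₂ Q A} (s : RunTree Q A) :
    ∀ {E : List A → Q → Prop} {B : Set (List A)} {w : List A} {q : Q} (t : List (List A)),
      N.Valid s E B w q → (toRun s q w t).IsChain N.Step ∧
        (∀ c ∈ toRun s q w t, ∀ u ∈ B, c.2 ≠ u :: t) ∧
        ∃ q' w', (toRun s q w t).getLast? = some (q', w' :: t) ∧ E w' q' := by
  have cons_chain : ∀ (c d : Q × List (List A)) (l : List _), N.Step c d → l.head? = some d →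
      l.IsChain N.Step → (c :: l).IsChain N.Step := by
    intro c d l h1 h2 h3
    cases l with
    | nil => simp
    | cons e l =>
      simp only [List.head?_cons, Option.some.injEq] at h2
      subst h2
      exact List.isChain_cons_cons.2 ⟨h1, h3⟩
  have cons_last : ∀ (c d : Q × List (List A)) (l : List _), l.getLast? = some d →
      (c :: l).getLast? = some d := by
    intro c d l h
    cases l with
    | nil => simp at h
    | cons e l => simpa [List.getLast?_cons_cons] using h
  have hd : ∀ (s : RunTree Q A) (q : Q) (w : List A) (t : List (List A)),
      (toRun s q w t).head? = some (q, w :: t) := by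
    intro s q w t
    obtain ⟨l, hl⟩ := exists_toRun_eq_cons s q w t
    simp [hl]
  have nb : ∀ (q : Q) (w : List A) (t : List (List A)) (B : Set (List A)), w ∉ B →
      ∀ u ∈ B, ((q, w :: t) : Q × List (List A)).2 ≠ u :: t := by
    rintro q w t B hw u hu e
    simp only [List.cons.injEq, and_true] at e
    exact hw (e ▸ hu)
  induction s with
  | leaf =>
    rintro E B w q t ⟨h1, h2⟩
    refine ⟨by simp [toRun], ?_, q, w, by simp [toRun], h2⟩
    intro c hc
    simp only [toRun, List.mem_singleton] at hc
    subst hc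
    exact nb _ _ _ _ h1
  | push a p s ih =>
    rintro E B w q t ⟨⟨h1, h, h2⟩, h3⟩
    obtain ⟨i1, i2, q', w', i3, i4⟩ := ih t h3
    refine ⟨cons_chain _ _ _ ((N.step_iff _ _ _ _).2 (.inl ⟨a, h, h2, rfl⟩)) (hd _ _ _ _) i1, ?_,
      q', w', cons_last _ _ _ i3, i4⟩
    intro c hc
    rcases List.mem_cons.1 hc with rfl | hc
    · exact nb _ _ _ _ h1
    · exact i2 c hc
  | pop p s ih =>
    rintro E B w q t ⟨⟨h1, h, h2⟩, h3⟩
    obtain ⟨i1, i2, q', w', i3, i4⟩ := ih t h3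
    refine ⟨cons_chain _ _ _ ((N.step_iff _ _ _ _).2 (.inr (.inl ⟨h, h2, rfl⟩)))
      (hd _ _ _ _) i1, ?_, q', w', cons_last _ _ _ i3, i4⟩
    intro c hc
    rcases List.mem_cons.1 hc with rfl | hc
    · exact nb _ _ _ _ h1
    · exact i2 c hc
  | clone p r s₁ s₂ ih₁ ih₂ =>
    rintro E B w q t ⟨⟨h1, h2⟩, h3, h4⟩
    obtain ⟨i1, -, p', u, i3, i4⟩ := ih₁ (w :: t) h3
    obtain ⟨j1, j2, q', w', j3, j4⟩ := ih₂ t h4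
    obtain ⟨m, hm⟩ := exists_toRun_eq_cons s₁ p w (w :: t)
    refine ⟨cons_chain _ (p, w :: w :: t) _
      ((N.step_iff _ _ _ _).2 (.inr (.inr (.inl ⟨h2, rfl⟩)))) (by simp [hm]) ?_, ?_,
      q', w', cons_last _ _ _ (by simp [List.getLast?_append, j3]), j4⟩
    · refine List.isChain_append.2 ⟨i1, j1, ?_⟩
      intro x hx y hy
      rw [i3] at hx
      rw [hd] at hy
      simp only [Option.mem_def, Option.some.injEq] at hx hy
      subst hx hy
      exact (N.step_iff _ _ _ _).2 (.inr (.inr (.inr ⟨by simp, i4, rfl⟩)))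
    · intro c hc
      rcases List.mem_cons.1 hc with rfl | hc
      · exact nb _ _ _ _ h1
      · rcases List.mem_append.1 hc with hc | hc
        · obtain ⟨y, hy, e⟩ := exists_stack_eq_append_of_mem_toRun _ _ _ _ c hc
          intro u _ e'
          have := congrArg List.length (e.symm.trans e')
          simp at this
          exact hy this
        · exact j2 c hc

/-- `ρ` is composed of returns of all the words of the list except for the last one, from top to
bottom, followed by a run described by a valid tree that starts in the last word above `t`. -/
def Parses (N : PDS₂ Q A) (E : List A → Q → Prop) (B : Set (List A)) (t : List (List A)) :
    Q → List (List A) → List (Q × List (List A)) → Prop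
  | _, [], _ => False
  | q, [w], ρ => ∃ s, N.Valid s E B w q ∧ ρ = toRun s q w t
  | q, w :: w₂ :: y, ρ => ∃ r s ρ₂, N.Valid s (N.RetEnd r) ∅ w q ∧ Parses N E B t r (w₂ :: y) ρ₂ ∧
      ρ = toRun s q w (w₂ :: y ++ t) ++ ρ₂

/-- Every run that stays above `t` and ends directly above `t` can be parsed. -/
theorem parses_of_isChain (N : PDS₂ Q A) (E : List A → Q → Prop) (B : Set (List A))
    (t : List (List A)) (q' : Q) (w' : List A) (hE : E w' q') :
    ∀ (ρ : List (Q × List (List A))) (q : Q) (y : List (List A)), y ≠ [] → ρ.IsChain N.Step →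
      ρ.head? = some (q, y ++ t) → ρ.getLast? = some (q', w' :: t) →
      (∀ c ∈ ρ, ∃ y ≠ [], c.2 = y ++ t) → (∀ c ∈ ρ, ∀ u ∈ B, c.2 ≠ u :: t) →
      N.Parses E B t q y ρ := by
  intro ρ
  induction ρ with
  | nil => intro q y _ _ h; simp at h
  | cons c ρ ih =>
    intro q y hy hch hh hl hab hB
    simp only [List.head?_cons, Option.some.injEq] at hh
    subst hh
    cases ρ with
    | nil =>
      simp only [List.getLast?_singleton, Option.some.injEq, Prod.mk.injEq] at hl
      obtain ⟨rfl, hl⟩ := hl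
      obtain rfl : y = [w'] := List.append_left_injective t (by simpa using hl)
      refine ⟨.leaf, ⟨fun h => ?_, hE⟩, by simp [toRun]⟩
      exact hB _ (List.mem_singleton_self _) w' h rfl
    | cons d ρ =>
      obtain ⟨hs, hch⟩ := List.isChain_cons_cons.1 hch
      rw [List.getLast?_cons_cons] at hl
      have hab' : ∀ c ∈ d :: ρ, ∃ y ≠ [], c.2 = y ++ t := fun c hc => hab c (by simp [hc])
      have hB' : ∀ c ∈ d :: ρ, ∀ u ∈ B, c.2 ≠ u :: t := fun c hc => hB c (by simp [hc])
      have IH : ∀ y, y ≠ [] → d.2 = y ++ t → N.Parses E B t d.1 y (d :: ρ) := fun y hy e =>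
        ih d.1 y hy hch (by simp [← e]) hl hab' hB'
      match y, hy with
      | [w], _ =>
        have hw : w ∉ B := fun h => hB _ List.mem_cons_self w h rfl
        rcases (N.step_iff _ _ _ _).1 hs with ⟨a, h, h1, h2⟩ | ⟨h, h1, h2⟩ | ⟨h1, h2⟩ | ⟨-, -, h2⟩
        · obtain ⟨s, hs, e⟩ := IH [a :: w] (by simp) (by simpa using h2)
          exact ⟨.push a d.1 s, ⟨⟨hw, h, h1⟩, hs⟩, by simp [toRun, e]⟩
        · obtain ⟨s, hs, e⟩ := IH [w.tail] (by simp) (by simpa using h2)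
          exact ⟨.pop d.1 s, ⟨⟨hw, h, h1⟩, hs⟩, by simp [toRun, e]⟩
        · obtain ⟨r, s₁, ρ₂, hs₁, ⟨s₂, hs₂, e₂⟩, e⟩ := IH [w, w] (by simp) (by simpa using h2)
          exact ⟨.clone d.1 r s₁ s₂, ⟨⟨hw, h1⟩, hs₁, hs₂⟩, by simp [toRun, e, e₂]⟩
        · obtain ⟨y, hy, e⟩ := hab' d (by simp)
          exact absurd (by simpa [h2] using e) hy
      | w :: w₂ :: y, _ =>
        rcases (N.step_iff _ _ _ _).1 hs with ⟨a, h, h1, h2⟩ | ⟨h, h1, h2⟩ | ⟨h1, h2⟩ | ⟨-, h1, h2⟩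
        · obtain ⟨r, s, ρ₂, hs, hp, e⟩ := IH ((a :: w) :: w₂ :: y) (by simp) (by simpa using h2)
          exact ⟨r, .push a d.1 s, ρ₂, ⟨⟨by simp, h, h1⟩, hs⟩, hp, by simp [toRun, e]⟩
        · obtain ⟨r, s, ρ₂, hs, hp, e⟩ := IH (w.tail :: w₂ :: y) (by simp) (by simpa using h2)
          exact ⟨r, .pop d.1 s, ρ₂, ⟨⟨by simp, h, h1⟩, hs⟩, hp, by simp [toRun, e]⟩
        · obtain ⟨r, s₁, ρ₂, hs₁, ⟨r', s₂, ρ₃, hs₂, hp, e₂⟩, e⟩ :=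
            IH (w :: w :: w₂ :: y) (by simp) (by simpa using h2)
          exact ⟨r', .clone d.1 r s₁ s₂, ρ₃, ⟨⟨by simp, h1⟩, hs₁, hs₂⟩, hp,
            by simp [toRun, e, e₂]⟩
        · exact ⟨d.1, .leaf, d :: ρ, ⟨by simp, h1⟩, IH (w₂ :: y) (by simp) (by simpa using h2),
            by simp [toRun]⟩

theorem Step.above_or_eq {N : PDS₂ Q A} {c d : Q × List (List A)} (h : N.Step c d)
    {t : List (List A)} (hc : ∃ y ≠ [], c.2 = y ++ t) :
    (∃ y ≠ [], d.2 = y ++ t) ∨ d.2 = t ∧ t ≠ [] ∧ ∃ u, c.2 = u :: t ∧ N.Enabled c.1 u d.1 .pop₂ := by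
  obtain ⟨q, s⟩ := c
  obtain ⟨y, hy, rfl : s = y ++ t⟩ := hc
  match y, hy with
  | w :: y, _ =>
    rcases (N.step_iff _ _ _ _).1 h with ⟨a, _, _, h⟩ | ⟨_, _, h⟩ | ⟨_, h⟩ | ⟨h1, h2, h3⟩
    · exact .inl ⟨(a :: w) :: y, by simp, h⟩
    · exact .inl ⟨w.tail :: y, by simp, h⟩
    · exact .inl ⟨w :: w :: y, by simp, h⟩
    · cases y with
      | nil => exact .inr ⟨h3, h1, w, rfl, h2⟩
      | cons w₂ y => exact .inl ⟨w₂ :: y, by simp, h3⟩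

/-- A run that starts above `t` and does not visit `t` stays above `t`. -/
theorem above_of_isChain {N : PDS₂ Q A} {t : List (List A)} :
    ∀ {ρ : List (Q × List (List A))} {c : Q × List (List A)}, ρ.IsChain N.Step →
      ρ.head? = some c → (∃ y ≠ [], c.2 = y ++ t) → (t ≠ [] → ∀ d ∈ ρ, d.2 ≠ t) →
      ∀ d ∈ ρ, ∃ y ≠ [], d.2 = y ++ t := by
  intro ρ
  induction ρ with
  | nil => simp
  | cons e ρ ih =>
    intro c hch hh hc hav d hd
    simp only [List.head?_cons, Option.some.injEq] at hh
    subst hh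
    rcases List.mem_cons.1 hd with rfl | hd
    · exact hc
    · cases ρ with
      | nil => simp at hd
      | cons f ρ =>
        obtain ⟨hs, hch⟩ := List.isChain_cons_cons.1 hch
        refine ih hch rfl ?_ (fun ht d hd => hav ht d (List.mem_cons_of_mem _ hd)) d hd
        rcases hs.above_or_eq hc with h | ⟨h, h', -⟩
        · exact h
        · exact absurd h (hav h' f (by simp))

/-- Runs between stacks of width one correspond to valid trees. -/
theorem encard_wordRuns_avoiding (N : PDS₂ Q A) (B : Set (List A)) (w w' : List A) (q q' : Q) :
    {ρ | N.IsRun ρ (q, [w]) (q', [w']) ∧ ∀ c ∈ ρ, ∀ u ∈ B, c.2 ≠ [u]}.encard =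
      {s | N.Valid s (WordEnd w' q') B w q}.encard := by
  rw [← (Function.Injective.injOn (f := fun s : RunTree Q A => toRun s q w [])
    fun s s' h => toRun_injective s s' q w [] h).encard_image]
  congr 1
  ext ρ
  constructor
  · rintro ⟨⟨h1, h2, h3⟩, h4⟩
    obtain ⟨s, hs, e⟩ := N.parses_of_isChain (WordEnd w' q') B [] q' w' ⟨rfl, rfl⟩ ρ q [w] (by simp)
      h1 (by simpa using h2) h3 (above_of_isChain h1 h2 ⟨[w], by simp⟩ (by simp)) h4
    exact ⟨s, hs, e.symm⟩
  · rintro ⟨s, hs, rfl⟩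
    obtain ⟨h1, h2, q'', w'', h3, rfl, rfl⟩ := hs.toRun_spec s []
    obtain ⟨l, hl⟩ := exists_toRun_eq_cons s q w []
    exact ⟨⟨h1, by simp [hl], h3⟩, h2⟩

theorem encard_wordRuns (N : PDS₂ Q A) (w w' : List A) (q q' : Q) :
    (N.wordRuns w w' q q').encard = {s | N.Valid s (WordEnd w' q') ∅ w q}.encard := by
  rw [← encard_wordRuns_avoiding]
  simp [wordRuns]

/-- Above the empty stack, the condition on loops is void. -/
theorem loops_nil (N : PDS₂ Q A) (w : List A) (q q' : Q) :
    N.loops w [] q q' = N.wordRuns w w q q' := by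
  ext ρ
  refine ⟨fun h => h.1, fun h => ⟨h, fun c hc => ?_⟩⟩
  obtain ⟨y, hy, e⟩ := above_of_isChain h.1 h.2.1 (t := []) ⟨[w], by simp⟩ (by simp) c hc
  simpa [e] using hy

theorem encard_loops (N : PDS₂ Q A) (w : List A) (q q' : Q) :
    (N.loops w [] q q').encard = {s | N.Valid s (WordEnd w q') ∅ w q}.encard := by
  rw [loops_nil, encard_wordRuns]

theorem encard_highLoops (N : PDS₂ Q A) (w : List A) (q q' : Q) :
    (N.highLoops w [] q q').encard = {s | N.Valid s (WordEnd w q') {w.tail} w q}.encard := by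
  rw [← encard_wordRuns_avoiding, highLoops, loops_nil]
  simp [wordRuns]

/-- Returns correspond to valid trees; in particular, their number does not depend on the stack
below. -/
theorem encard_returns (N : PDS₂ Q A) (w : List A) (t : List (List A)) (ht : t ≠ []) (q q' : Q) :
    (N.returns w t q q').encard = {s | N.Valid s (N.RetEnd q') ∅ w q}.encard := by
  rw [← (Function.Injective.injOn (f := fun s : RunTree Q A => toRun s q w t ++ [(q', t)])
    fun s s' h => toRun_injective s s' q w t (List.append_left_injective _ h)).encard_image]
  congr 1
  ext ρ
  constructor
  · rintro ⟨⟨h1, h2, h3⟩, h4⟩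
    obtain ⟨ρ, rfl⟩ := List.getLast?_eq_some_iff.1 h3
    rw [List.dropLast_concat] at h4
    obtain ⟨h5, -, h6⟩ := List.isChain_append.1 h1
    rcases List.eq_nil_or_concat' ρ with rfl | ⟨ρ', ⟨p, s⟩, rfl⟩
    · simp at h2
    have hh : (ρ' ++ [(p, s)]).head? = some (q, w :: t) := by
      rw [← h2]
      cases ρ' <;> simp
    have hab := above_of_isChain h5 hh ⟨[w], by simp⟩ (fun _ => h4)
    have hst : N.Step (p, s) (q', t) := h6 _ (by simp) _ (by simp)
    rcases hst.above_or_eq (hab (p, s) (by simp)) with ⟨y, hy, e⟩ | ⟨-, -, u, hu, hp⟩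
    · exact absurd (by simpa using e) hy
    · simp only at hu hp
      subst hu
      obtain ⟨s, hs, e⟩ := N.parses_of_isChain (N.RetEnd q') ∅ t p u hp _ q [w] (by simp)
        h5 (by simpa using hh) (by simp) hab (by simp)
      exact ⟨s, hs, by simp [e]⟩
  · rintro ⟨s, hs, rfl⟩
    obtain ⟨h1, -, p, u, h3, h4⟩ := hs.toRun_spec s t
    obtain ⟨l, hl⟩ := exists_toRun_eq_cons s q w t
    refine ⟨⟨List.isChain_append.2 ⟨h1, by simp, ?_⟩, by simp [hl], by simp⟩, ?_⟩
    · intro x hx y hy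
      rw [h3] at hx
      simp only [Option.mem_def, Option.some.injEq, List.head?_cons] at hx hy
      subst hx hy
      exact (N.step_iff _ _ _ _).2 (.inr (.inr (.inr ⟨ht, h4, rfl⟩)))
    · rw [List.dropLast_concat]
      intro c hc e
      obtain ⟨y, hy, e'⟩ := exists_stack_eq_append_of_mem_toRun _ _ _ _ c hc
      rw [e] at e'
      exact hy (by simpa using e')

end PDS₂

/-! ### Counting up to a threshold -/

/-- `a ≤ b`, up to the threshold `z`: equivalent to `min z a ≤ b`. -/
def LeUpTo (z a b : ℕ∞) : Prop := a ≤ b ∨ z ≤ b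

namespace LeUpTo

variable {z a b a' b' : ℕ∞}

theorem mono_left (h : LeUpTo z a b) (h' : a' ≤ a) : LeUpTo z a' b :=
  h.imp h'.trans id

theorem add (h : LeUpTo z a b) (h' : LeUpTo z a' b') : LeUpTo z (a + a') (b + b') := by
  rcases h with h | h
  · rcases h' with h' | h'
    · exact .inl (add_le_add h h')
    · exact .inr (h'.trans le_add_self)
  · exact .inr (h.trans le_self_add)

theorem mul (h : LeUpTo z a b) (h' : LeUpTo z a' b') : LeUpTo z (a * a') (b * b') := by
  have key : ∀ {a b a' b' : ℕ∞}, z ≤ b → LeUpTo z a' b' → LeUpTo z (a * a') (b * b') := by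
    intro a b a' b' h h'
    by_cases hb : b' = 0
    · rcases h' with h' | h'
      · exact .inl (by simp_all)
      · exact .inr (by simp_all)
    · refine .inr (h.trans ?_)
      calc b = b * 1 := (mul_one b).symm
        _ ≤ b * b' := by gcongr; exact Order.one_le_iff_ne_zero.2 hb
  rcases h with h | h
  · rcases h' with h' | h'
    · exact .inl (mul_le_mul' h h')
    · rw [mul_comm a, mul_comm b]
      exact key h' (.inl h)
  · exact key h h'

theorem sum {ι : Type*} {s : Finset ι} {f g : ι → ℕ∞} (h : ∀ i, LeUpTo z (f i) (g i)) :
    LeUpTo z (∑ i ∈ s, f i) (∑ i ∈ s, g i) := by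
  classical
  induction s using Finset.induction_on with
  | empty => exact .inl (by simp)
  | insert i s hi ih => simpa [Finset.sum_insert hi] using (h i).add ih

/-- A finite union can be compared with a finite disjoint union termwise. -/
theorem encard_iUnion {ι X Y : Type*} [Finite ι] {S : ι → Set X} {S' : ι → Set Y}
    (hS' : Pairwise (Function.onFun Disjoint S'))
    (h : ∀ i, LeUpTo z (S i).encard (S' i).encard) :
    LeUpTo z (⋃ i, S i).encard (⋃ i, S' i).encard := by
  have := Fintype.ofFinite ι
  rw [Set.encard_iUnion_of_finite hS', finsum_eq_sum_of_fintype]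
  exact (sum h).mono_left (Set.encard_iUnion_le_of_fintype S)

theorem encard_and {X Y : Type*} {P P' : Prop} {T : Set X} {T' : Set Y} (hP : P ↔ P')
    (h : LeUpTo z T.encard T'.encard) :
    LeUpTo z {s | P ∧ s ∈ T}.encard {s | P' ∧ s ∈ T'}.encard := by
  by_cases hp : P
  · have hp' := hP.1 hp
    simpa [hp, hp'] using h
  · exact .inl (by simp [hp])

/-- It suffices to bound the sizes of the subsets on which a function is bounded. -/
theorem encard_of_forall_nat {X Y : Type*} {S : Set X} {S' : Set Y} (f : X → ℕ)
    (h : ∀ d, LeUpTo z {x | x ∈ S ∧ f x ≤ d}.encard S'.encard) :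
    LeUpTo z S.encard S'.encard := by
  by_contra hc
  simp only [LeUpTo, not_or, not_le] at hc
  obtain ⟨T, hT, hT'⟩ := Set.exists_subset_encard_eq (Order.add_one_le_of_lt hc.1)
  have hfin : T.Finite := by
    rw [← Set.encard_lt_top_iff, hT']
    exact lt_of_le_of_ne le_top fun e => by
      have : S'.encard = ⊤ := by simpa using e
      simp [this] at hc
  obtain ⟨d, hd⟩ := (hfin.image f).bddAbove
  have hsub : T ⊆ {x | x ∈ S ∧ f x ≤ d} := fun x hx =>
    ⟨hT hx, hd (Set.mem_image_of_mem f hx)⟩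
  have hle := ((h d).mono_left (Set.encard_le_encard hsub)).resolve_right (not_le.2 hc.2)
  rw [hT'] at hle
  have hne : S'.encard ≠ ⊤ := fun e => by simp [e] at hc
  exact absurd ((ENat.lt_add_one_iff hne).2 le_rfl) (not_lt.2 hle)

end LeUpTo

theorem countUpTo_eq_iff {X Y : Type*} (z : ℕ) (S : Set X) (T : Set Y) :
    PDS₂.countUpTo z S = PDS₂.countUpTo z T ↔
      LeUpTo z S.encard T.encard ∧ LeUpTo z T.encard S.encard := by
  have h1 : ∀ a : ℕ∞, ((min (z : ℕ∞) a).toNat : ℕ∞) = min (z : ℕ∞) a := fun a =>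
    ENat.natCast_toNat (ne_top_of_le_ne_top (ENat.natCast_ne_top z) (min_le_left _ _))
  rw [PDS₂.countUpTo, PDS₂.countUpTo, Fin.mk.injEq, ← Nat.cast_inj (R := ℕ∞), h1, h1]
  simp only [LeUpTo]
  constructor
  · intro h
    constructor
    · by_contra hc
      simp only [not_or, not_le] at hc
      rw [min_eq_right hc.2.le] at h
      exact absurd h (lt_min hc.2 hc.1).ne'
    · by_contra hc
      simp only [not_or, not_le] at hc
      rw [min_eq_right hc.2.le] at h
      exact absurd h (lt_min hc.2 hc.1).ne
  · rintro ⟨h1 | h1, h2 | h2⟩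
    · rw [le_antisymm h1 h2]
    · rw [min_eq_left h2, min_eq_left (h2.trans h1)]
    · rw [min_eq_left h1, min_eq_left (h1.trans h2)]
    · rw [min_eq_left h1, min_eq_left h2]

theorem natCast_le_of_leUpTo {z : ℕ} {a b : ℕ∞} (h : LeUpTo z a b) (j : Fin (z + 1))
    (hj : ((j : ℕ) : ℕ∞) ≤ a) : ((j : ℕ) : ℕ∞) ≤ b := by
  rcases h with h | h
  · exact hj.trans h
  · exact le_trans (by exact_mod_cast Nat.lt_succ_iff.1 j.2) h

theorem leUpTo_of_forall_natCast_le {z : ℕ} {a b : ℕ∞}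
    (h : ∀ j : Fin (z + 1), ((j : ℕ) : ℕ∞) ≤ a → ((j : ℕ) : ℕ∞) ≤ b) : LeUpTo z a b := by
  by_contra hc
  simp only [LeUpTo, not_or, not_le] at hc
  obtain ⟨n, rfl⟩ := ENat.ne_top_iff_exists.1 (ne_top_of_lt hc.1)
  have hn : n < z := by exact_mod_cast hc.2
  have := h ⟨n + 1, by omega⟩ (by simpa using Order.add_one_le_of_lt hc.1)
  have : n + 1 ≤ n := by exact_mod_cast this
  omega

namespace RunTree

variable {Q : Type u} {A : Type v}

/-- The depth of a tree. -/
def depth : RunTree Q A → ℕ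
  | leaf => 1
  | push _ _ s => s.depth + 1
  | pop _ s => s.depth + 1
  | clone _ _ s₁ s₂ => max s₁.depth s₂.depth + 1

/-- The root of a tree. -/
def root : RunTree Q A → Unit ⊕ (A × Q) ⊕ Q ⊕ (Q × Q)
  | leaf => .inl ()
  | push a p _ => .inr (.inl (a, p))
  | pop p _ => .inr (.inr (.inl p))
  | clone p r _ _ => .inr (.inr (.inr (p, r)))

/-- Sets of trees can be compared up to a threshold separately for each possible root. -/
theorem leUpTo_encard [Finite Q] [Finite A] {z : ℕ∞} {S S' : Set (RunTree Q A)}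
    (hleaf : leaf ∈ S → leaf ∈ S')
    (hpush : ∀ a p, LeUpTo z {s | push a p s ∈ S}.encard {s | push a p s ∈ S'}.encard)
    (hpop : ∀ p, LeUpTo z {s | pop p s ∈ S}.encard {s | pop p s ∈ S'}.encard)
    (hclone : ∀ p r, LeUpTo z {s : RunTree Q A × RunTree Q A | clone p r s.1 s.2 ∈ S}.encard
      {s : RunTree Q A × RunTree Q A | clone p r s.1 s.2 ∈ S'}.encard) :
    LeUpTo z S.encard S'.encard := by
  have hU : ∀ S : Set (RunTree Q A), S = ⋃ i, {s | s ∈ S ∧ s.root = i} := fun S => by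
    ext s
    simp
  rw [hU S, hU S']
  refine LeUpTo.encard_iUnion ?_ ?_
  · intro i j hij
    refine Set.disjoint_left.2 ?_
    rintro s ⟨-, rfl⟩ ⟨-, h⟩
    exact hij h
  rintro (⟨⟩ | ⟨a, p⟩ | p | ⟨p, r⟩)
  · refine .inl (Set.encard_le_encard ?_)
    rintro s ⟨hs, h⟩
    cases s <;> simp [root] at h
    exact ⟨hleaf hs, rfl⟩
  · have h : ∀ S : Set (RunTree Q A), {s | s ∈ S ∧ s.root = .inr (.inl (a, p))} =
        (fun s => push a p s) '' {s | push a p s ∈ S} := by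
      intro S
      ext s
      cases s <;> (simp [root]; try grind)
    have hi : Function.Injective fun s : RunTree Q A => push a p s := fun s s' h => by simpa using h
    rw [h S, h S', hi.injOn.encard_image, hi.injOn.encard_image]
    exact hpush a p
  · have h : ∀ S : Set (RunTree Q A), {s | s ∈ S ∧ s.root = .inr (.inr (.inl p))} =
        (fun s => pop p s) '' {s | pop p s ∈ S} := by
      intro S
      ext s
      cases s <;> (simp [root]; try grind)
    have hi : Function.Injective fun s : RunTree Q A => pop p s := fun s s' h => by simpa using h
    rw [h S, h S', hi.injOn.encard_image, hi.injOn.encard_image]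
    exact hpop p
  · have h : ∀ S : Set (RunTree Q A), {s | s ∈ S ∧ s.root = .inr (.inr (.inr (p, r)))} =
        (fun s : RunTree Q A × RunTree Q A => clone p r s.1 s.2) ''
          {s | clone p r s.1 s.2 ∈ S} := by
      intro S
      ext s
      cases s <;> (simp [root]; try grind)
    have hi : Function.Injective fun s : RunTree Q A × RunTree Q A => clone p r s.1 s.2 :=
      fun s s' h => by simpa [Prod.ext_iff] using h
    rw [h S, h S', hi.injOn.encard_image, hi.injOn.encard_image]
    exact hclone p r

/-- The tree of the concatenation of two runs. -/
def glue : RunTree Q A → RunTree Q A → RunTree Q A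
  | leaf, u => u
  | push a p s, u => push a p (s.glue u)
  | pop p s, u => pop p (s.glue u)
  | clone p r s₁ s₂, u => clone p r s₁ (s₂.glue u)

end RunTree

namespace PDS₂

variable {Q : Type u} {A : Type v}

/-! ### Numbers of runs after replacing the lower part of a word -/

/-- The numbers of runs from `x ++ v` up to a threshold depend only on `x`, on the numbers of
returns of `v`, and on the numbers of runs of the same kind from `v`: a run from `x ++ v`
never inspects `v` except in parts that start in `v`. -/
theorem leUpTo_encard_valid_append [Finite Q] [Finite A] (N : PDS₂ Q A) {z : ℕ∞} {v v' : List A}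
    (hv : v ≠ []) (hv' : v' ≠ [])
    (hret : ∀ q r, LeUpTo z {s | N.Valid s (N.RetEnd r) ∅ v q}.encard
      {s | N.Valid s (N.RetEnd r) ∅ v' q}.encard)
    {E E' : List A → Q → Prop} {B B' : Set (List A)}
    (hE : ∀ x ≠ [], ∀ q, E (x ++ v) q ↔ E' (x ++ v') q)
    (hB : ∀ x ≠ [], x ++ v ∈ B ↔ x ++ v' ∈ B')
    (hbase : ∀ q, LeUpTo z {s | N.Valid s E B v q}.encard {s | N.Valid s E' B' v' q}.encard)
    (x : List A) (q : Q) :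
    LeUpTo z {s | N.Valid s E B (x ++ v) q}.encard
      {s | N.Valid s E' B' (x ++ v') q}.encard := by
  refine LeUpTo.encard_of_forall_nat RunTree.depth fun d => ?_
  induction d generalizing E E' B B' x q with
  | zero =>
    refine .inl ?_
    rw [Set.encard_eq_zero.2]
    · exact zero_le
    · ext s
      cases s <;> simp [RunTree.depth]
  | succ d ih =>
    cases x with
    | nil => exact (hbase q).mono_left (Set.encard_le_encard fun s hs => hs.1)
    | cons a x =>
      have hB' : a :: (x ++ v) ∈ B ↔ a :: (x ++ v') ∈ B' := hB (a :: x) (by simp)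
      have hE' : ∀ q, E (a :: (x ++ v)) q ↔ E' (a :: (x ++ v')) q := hE (a :: x) (by simp)
      have hen := fun p op => N.enabled_congr (w := a :: (x ++ v)) (w' := a :: (x ++ v'))
        (by simp) q p op
      apply RunTree.leUpTo_encard
      · rintro ⟨h, -⟩
        simpa [Valid, hB', hE'] using h
      · intro b p
        have := LeUpTo.encard_and (P := a :: (x ++ v) ∉ B ∧ ∃ h, N.Enabled q (a :: (x ++ v)) p (.push b h))
          (P' := a :: (x ++ v') ∉ B' ∧ ∃ h, N.Enabled q (a :: (x ++ v')) p (.push b h))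
          (by simp only [hB', hen]) (ih hE hB hbase (b :: a :: x) p)
        convert this using 2 <;>
        · ext s
          simp [Valid, RunTree.depth, and_assoc]
      · intro p
        have := LeUpTo.encard_and
          (P := a :: (x ++ v) ∉ B ∧ x ++ v ≠ [] ∧ N.Enabled q (a :: (x ++ v)) p .pop₁)
          (P' := a :: (x ++ v') ∉ B' ∧ x ++ v' ≠ [] ∧ N.Enabled q (a :: (x ++ v')) p .pop₁)
          (by simp [hB', hen, hv, hv']) (ih hE hB hbase x p)
        convert this using 2 <;>
        · ext s
          simp [Valid, RunTree.depth, and_assoc]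
      · intro p r
        have h1 := ih (E := N.RetEnd r) (E' := N.RetEnd r) (B := ∅) (B' := ∅)
          (fun y hy q => N.enabled_congr (by cases y <;> simp_all) _ _ _) (by simp)
          (fun q => hret q r) (a :: x) p
        have h2 := ih hE hB hbase (a :: x) r
        have h3 := h1.mul h2
        rw [← Set.encard_prod, ← Set.encard_prod] at h3
        have h4 : LeUpTo z {s : RunTree Q A × RunTree Q A |
            (a :: (x ++ v) ∉ B ∧ N.Enabled q (a :: (x ++ v)) p .clone₂) ∧ s ∈ _}.encard
          {s : RunTree Q A × RunTree Q A |
            (a :: (x ++ v') ∉ B' ∧ N.Enabled q (a :: (x ++ v')) p .clone₂) ∧ s ∈ _}.encard :=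
          LeUpTo.encard_and (by simp only [hB', hen]) h3
        convert h4 using 2
        · ext s
          simp only [Set.mem_ofPred_eq, Valid, RunTree.depth, List.cons_append, Set.mem_prod,
            Nat.add_le_add_iff_right, max_le_iff]
          tauto
        · ext s
          simp only [Set.mem_ofPred_eq, Valid, List.cons_append, Set.mem_prod]

/-- A run that ends in `a :: v` and does not visit `v` stays above `a :: v`. -/
theorem Valid.exists_eq_append {N : PDS₂ Q A} {a : A} {v : List A} {q' : Q} (s : RunTree Q A) :
    ∀ {w : List A} {q : Q}, N.Valid s (WordEnd (a :: v) q') {v} w q → ∃ x, w = x ++ a :: v := by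
  induction s with
  | leaf => rintro w q ⟨-, rfl, -⟩; exact ⟨[], rfl⟩
  | push b p s ih =>
    rintro w q ⟨⟨hw, -⟩, h⟩
    obtain ⟨x, hx⟩ := ih h
    cases x with
    | nil => simp_all
    | cons c x => exact ⟨x, by simp_all⟩
  | pop p s ih =>
    rintro w q ⟨⟨-, hw, -⟩, h⟩
    obtain ⟨x, hx⟩ := ih h
    obtain ⟨c, w, rfl⟩ := List.exists_cons_of_ne_nil (l := w) (by rintro rfl; simp at hw)
    exact ⟨c :: x, by simpa using hx⟩
  | clone p r s₁ s₂ ih₁ ih₂ =>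
    rintro w q ⟨-, -, h⟩
    exact ih₂ h

theorem Valid.not_mem {N : PDS₂ Q A} {s : RunTree Q A} {E : List A → Q → Prop} {B : Set (List A)}
    {w : List A} {q : Q} (h : N.Valid s E B w q) : w ∉ B := by
  cases s with
  | leaf => exact h.1
  | push | pop | clone => exact h.1.1

theorem Valid.glue {N : PDS₂ Q A} {v : List A} {p : Q} {E : List A → Q → Prop} {u : RunTree Q A}
    (hu : N.Valid u E ∅ v p) (s : RunTree Q A) :
    ∀ {w : List A} {q : Q}, N.Valid s (WordEnd v p) ∅ w q → N.Valid (s.glue u) E ∅ w q := by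
  induction s with
  | leaf => rintro w q ⟨-, rfl, rfl⟩; exact hu
  | push a p s ih | pop p s ih => rintro w q ⟨h, h'⟩; exact ⟨h, ih h'⟩
  | clone p r s₁ s₂ ih₁ ih₂ => rintro w q ⟨h, h', h''⟩; exact ⟨h, h', ih₂ h''⟩

/-- A run composed of a run to `v` and another run visits `v`. -/
theorem Valid.not_valid_glue {N : PDS₂ Q A} {v : List A} {p : Q} {E : List A → Q → Prop}
    {u : RunTree Q A} (s : RunTree Q A) : ∀ {w : List A} {q : Q},
      N.Valid s (WordEnd v p) ∅ w q → ¬ N.Valid (s.glue u) E {v} w q := by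
  induction s with
  | leaf => rintro w q ⟨-, rfl, rfl⟩ h; exact h.not_mem rfl
  | push a p s ih | pop p s ih => rintro w q ⟨-, h⟩ h'; exact ih h h'.2
  | clone p r s₁ s₂ ih₁ ih₂ => rintro w q ⟨-, -, h⟩ h'; exact ih₂ h h'.2.2

/-- Uniqueness of the decomposition of a run at its last visit to `v`. -/
theorem Valid.glue_inj {N : PDS₂ Q A} {v : List A} {a : A} {p p' r r' : Q}
    {E : List A → Q → Prop} {u u' : RunTree Q A} (hu : N.Valid u E {v} (a :: v) r)
    (hu' : N.Valid u' E {v} (a :: v) r') (s : RunTree Q A) :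
    ∀ (s' : RunTree Q A) {w : List A} {q : Q}, N.Valid s (WordEnd v p) ∅ w q →
      N.Valid s' (WordEnd v p') ∅ w q → s.glue (.push a r u) = s'.glue (.push a r' u') →
      p = p' ∧ r = r' ∧ s = s' ∧ u = u' := by
  induction s with
  | leaf =>
    rintro s' w q ⟨-, rfl, rfl⟩ h' e
    cases s' with
    | leaf =>
      obtain ⟨-, -, rfl⟩ := h'
      simpa [RunTree.glue] using e
    | push b p s' =>
      simp only [RunTree.glue, RunTree.push.injEq] at e
      obtain ⟨rfl, rfl, rfl⟩ := e
      exact absurd hu (h'.2.not_valid_glue)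
    | pop | clone => simp [RunTree.glue] at e
  | push b t s ih =>
    rintro s' w q h h' e
    cases s' with
    | leaf =>
      simp only [RunTree.glue, RunTree.push.injEq] at e
      obtain ⟨rfl, rfl, rfl⟩ := e
      obtain ⟨-, rfl, rfl⟩ := h'
      exact absurd hu' (h.2.not_valid_glue)
    | push b' t' s' =>
      simp only [RunTree.glue, RunTree.push.injEq] at e
      obtain ⟨rfl, rfl, e⟩ := e
      obtain ⟨h1, h2, rfl, h4⟩ := ih s' h.2 h'.2 e
      exact ⟨h1, h2, rfl, h4⟩
    | pop | clone => simp [RunTree.glue] at e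
  | pop t s ih =>
    rintro s' w q h h' e
    cases s' with
    | pop t' s' =>
      simp only [RunTree.glue, RunTree.pop.injEq] at e
      obtain ⟨rfl, e⟩ := e
      obtain ⟨h1, h2, rfl, h4⟩ := ih s' h.2 h'.2 e
      exact ⟨h1, h2, rfl, h4⟩
    | leaf | push | clone => simp [RunTree.glue] at e
  | clone t₁ t₂ s₁ s₂ ih₁ ih₂ =>
    rintro s' w q h h' e
    cases s' with
    | clone t₁' t₂' s₁' s₂' =>
      simp only [RunTree.glue, RunTree.clone.injEq] at e
      obtain ⟨rfl, rfl, rfl, e⟩ := e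
      obtain ⟨h1, h2, rfl, h4⟩ := ih₂ s₂' h.2.2 h'.2.2 e
      exact ⟨h1, h2, rfl, h4⟩
    | leaf | push | pop => simp [RunTree.glue] at e

/-- A run to `a :: v` either avoids `v` or decomposes at its last visit to `v`, where it continues
by pushing `a`. -/
theorem Valid.avoids_or_exists_glue {N : PDS₂ Q A} {v : List A} {a : A} {q' : Q}
    (s : RunTree Q A) : ∀ {w : List A} {q : Q}, N.Valid s (WordEnd (a :: v) q') ∅ w q →
      N.Valid s (WordEnd (a :: v) q') {v} w q ∨ ∃ p r t u, (∃ h, N.Enabled p v r (.push a h)) ∧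
        N.Valid t (WordEnd v p) ∅ w q ∧ N.Valid u (WordEnd (a :: v) q') {v} (a :: v) r ∧
        s = t.glue (.push a r u) := by
  induction s with
  | leaf => rintro w q ⟨-, rfl, rfl⟩; exact .inl ⟨by simp, rfl, rfl⟩
  | push b p' s ih =>
    rintro w q ⟨⟨-, h⟩, h'⟩
    rcases ih h' with i | ⟨p, r, t, u, h1, h2, h3, rfl⟩
    · by_cases hw : w = v
      · subst hw
        obtain ⟨x, hx⟩ := i.exists_eq_append
        obtain rfl : x = [] := by
          have := congrArg List.length hx
          simp only [List.length_append, List.length_cons] at this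
          exact List.eq_nil_of_length_eq_zero (by omega)
        obtain rfl : b = a := by simpa using hx
        exact .inr ⟨q, p', .leaf, s, h, ⟨by simp, rfl, rfl⟩, i, rfl⟩
      · exact .inl ⟨⟨hw, h⟩, i⟩
    · exact .inr ⟨p, r, .push b p' t, u, h1, ⟨⟨by simp, h⟩, h2⟩, h3, rfl⟩
  | pop p' s ih =>
    rintro w q ⟨⟨-, h⟩, h'⟩
    rcases ih h' with i | ⟨p, r, t, u, h1, h2, h3, rfl⟩
    · refine .inl ⟨⟨?_, h⟩, i⟩
      rintro rfl
      obtain ⟨x, hx⟩ := i.exists_eq_append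
      have := congrArg List.length hx
      simp only [List.length_append, List.length_cons, List.length_tail] at this
      omega
    · exact .inr ⟨p, r, .pop p' t, u, h1, ⟨⟨by simp, h⟩, h2⟩, h3, rfl⟩
  | clone p' r' s₁ s₂ ih₁ ih₂ =>
    rintro w q ⟨⟨-, h⟩, h', h''⟩
    rcases ih₂ h'' with i | ⟨p, r, t, u, h1, h2, h3, rfl⟩
    · exact .inl ⟨⟨i.not_mem, h⟩, h', i⟩
    · exact .inr ⟨p, r, .clone p' r' s₁ t, u, h1, ⟨⟨by simp, h⟩, h', h2⟩, h3, rfl⟩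

theorem Valid.of_subset {N : PDS₂ Q A} {E : List A → Q → Prop} {B B' : Set (List A)} (hB : B' ⊆ B)
    (s : RunTree Q A) : ∀ {w : List A} {q : Q}, N.Valid s E B w q → N.Valid s E B' w q := by
  induction s with
  | leaf => rintro w q ⟨h, h'⟩; exact ⟨fun i => h (hB i), h'⟩
  | push a p s ih | pop p s ih =>
    rintro w q ⟨⟨h, h'⟩, h''⟩; exact ⟨⟨fun i => h (hB i), h'⟩, ih h''⟩
  | clone p r s₁ s₂ ih₁ ih₂ =>
    rintro w q ⟨⟨h, h'⟩, i, j⟩; exact ⟨⟨fun i => h (hB i), h'⟩, i, ih₂ j⟩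

/-- Runs from `v` to `a :: v` are composed of a loop of `v`, a transition that pushes `a`, and a
high loop of `a :: v`. -/
theorem leUpTo_encard_valid_cons_end [Finite Q] (N : PDS₂ Q A) {z : ℕ∞} {a : A}
    {v v' : List A} (hv : v.head? = v'.head?) {q' : Q}
    (hloop : ∀ q p, LeUpTo z {s | N.Valid s (WordEnd v p) ∅ v q}.encard
      {s | N.Valid s (WordEnd v' p) ∅ v' q}.encard)
    (hhigh : ∀ r, LeUpTo z {s | N.Valid s (WordEnd (a :: v) q') {v} (a :: v) r}.encard
      {s | N.Valid s (WordEnd (a :: v') q') {v'} (a :: v') r}.encard) (q : Q) :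
    LeUpTo z {s | N.Valid s (WordEnd (a :: v) q') ∅ v q}.encard
      {s | N.Valid s (WordEnd (a :: v') q') ∅ v' q}.encard := by
  set S : List A → Q × Q → Set (RunTree Q A × RunTree Q A) := fun v x =>
    {y | (∃ h, N.Enabled x.1 v x.2 (.push a h)) ∧ y ∈ {s | N.Valid s (WordEnd v x.1) ∅ v q} ×ˢ
      {s | N.Valid s (WordEnd (a :: v) q') {v} (a :: v) x.2}} with hS
  set g : Q × Q → RunTree Q A × RunTree Q A → RunTree Q A := fun x y =>
    y.1.glue (.push a x.2 y.2) with hg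
  have hU : ∀ v, {s | N.Valid s (WordEnd (a :: v) q') ∅ v q} = ⋃ x, g x '' S v x := by
    intro v
    ext s
    simp only [Set.mem_ofPred_eq, Set.mem_iUnion, Set.mem_image]
    constructor
    · intro h
      rcases h.avoids_or_exists_glue with h | ⟨p, r, t, u, h1, h2, h3, rfl⟩
      · exact absurd rfl h.not_mem
      · exact ⟨(p, r), (t, u), ⟨h1, h2, h3⟩, rfl⟩
    · rintro ⟨⟨p, r⟩, ⟨t, u⟩, ⟨h1, h2, h3⟩, rfl⟩
      exact Valid.glue (u := .push a r u) ⟨⟨by simp, h1⟩, h3.of_subset (by simp)⟩ t h2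
  have hinj : ∀ v x, Set.InjOn (g x) (S v x) := by
    rintro v ⟨p, r⟩ ⟨t, u⟩ ⟨-, h2, h3⟩ ⟨t', u'⟩ ⟨-, h2', h3'⟩ e
    obtain ⟨-, -, rfl, rfl⟩ := Valid.glue_inj h3 h3' t t' h2 h2' e
    rfl
  rw [hU v, hU v']
  refine LeUpTo.encard_iUnion ?_ ?_
  · rintro ⟨p, r⟩ ⟨p', r'⟩ hne
    refine Set.disjoint_left.2 ?_
    rintro s ⟨⟨t, u⟩, ⟨-, h2, h3⟩, rfl⟩ ⟨⟨t', u'⟩, ⟨-, h2', h3'⟩, e⟩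
    obtain ⟨rfl, rfl, -⟩ := Valid.glue_inj h3 h3' t t' h2 h2' e.symm
    exact hne rfl
  · rintro ⟨p, r⟩
    rw [(hinj v _).encard_image, (hinj v' _).encard_image]
    by_cases h : ∃ h, N.Enabled p v r (.push a h)
    · have h' : ∃ h, N.Enabled p v' r (.push a h) := by simpa [N.enabled_congr hv] using h
      have := (hloop q p).mul (hhigh r)
      rw [← Set.encard_prod, ← Set.encard_prod] at this
      exact LeUpTo.encard_and (by simp only [h, h']) this
    · exact .inl (by simp [hS, h])

/-! ### Counting functions of a word with one more letter -/

section Cons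

variable (N : PDS₂ Q A) {z : ℕ} {v v' : List A}

theorem leUpTo_of_returnFunc_eq (h : N.returnFunc z v = N.returnFunc z v') (q r : Q) :
    LeUpTo z {s | N.Valid s (N.RetEnd r) ∅ v q}.encard
      {s | N.Valid s (N.RetEnd r) ∅ v' q}.encard := by
  have := ((countUpTo_eq_iff z _ _).1 (congrFun h (q, r))).1
  rwa [encard_returns _ _ _ (by simp), encard_returns _ _ _ (by simp)] at this

theorem leUpTo_of_loopFunc_eq (h : N.loopFunc z v = N.loopFunc z v') (q r : Q) :
    LeUpTo z {s | N.Valid s (WordEnd v r) ∅ v q}.encard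
      {s | N.Valid s (WordEnd v' r) ∅ v' q}.encard := by
  have := ((countUpTo_eq_iff z _ _).1 (congrFun h (q, r))).1
  rwa [encard_loops, encard_loops] at this

variable [Finite Q] [Finite A]

theorem returnFunc_cons (hv : v ≠ []) (hv' : v' ≠ []) (h : N.returnFunc z v = N.returnFunc z v')
    (a : A) : N.returnFunc z (a :: v) = N.returnFunc z (a :: v') := by
  have key : ∀ {v v'}, v ≠ [] → v' ≠ [] → N.returnFunc z v = N.returnFunc z v' → ∀ q r,
      LeUpTo z {s | N.Valid s (N.RetEnd r) ∅ (a :: v) q}.encard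
        {s | N.Valid s (N.RetEnd r) ∅ (a :: v') q}.encard := by
    intro v v' hv hv' h q r
    exact N.leUpTo_encard_valid_append hv hv' (N.leUpTo_of_returnFunc_eq h)
      (fun y hy q => N.enabled_congr (by cases y <;> simp_all) _ _ _) (by simp)
      (fun q => N.leUpTo_of_returnFunc_eq h q r) [a] q
  funext ⟨q, r⟩
  refine (countUpTo_eq_iff z _ _).2 ?_
  rw [encard_returns _ _ _ (by simp), encard_returns _ _ _ (by simp)]
  exact ⟨key hv hv' h q r, key hv' hv h.symm q r⟩

theorem leUpTo_encard_highLoop_cons (hv : v ≠ []) (hv' : v' ≠ [])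
    (h : N.returnFunc z v = N.returnFunc z v') (a : A) (q r : Q) :
    LeUpTo z {s | N.Valid s (WordEnd (a :: v) r) {v} (a :: v) q}.encard
      {s | N.Valid s (WordEnd (a :: v') r) {v'} (a :: v') q}.encard := by
  refine N.leUpTo_encard_valid_append hv hv' (N.leUpTo_of_returnFunc_eq h) ?_ ?_ ?_ [a] q
  · intro x _ q
    simp only [WordEnd, show ∀ v : List A, x ++ v = a :: v ↔ x = [a] from fun v =>
      List.append_left_inj (s₁ := x) (s₂ := [a]) v]
  · intro x _
    simp
  · intro q
    refine .inl ?_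
    rw [Set.encard_eq_zero.2]
    · exact zero_le
    · ext s
      exact iff_of_false (fun h => Valid.not_mem h rfl) (by simp)

theorem highLoopFunc_cons (hv : v ≠ []) (hv' : v' ≠ [])
    (h : N.returnFunc z v = N.returnFunc z v') (a : A) :
    N.highLoopFunc z (a :: v) = N.highLoopFunc z (a :: v') := by
  funext ⟨q, r⟩
  refine (countUpTo_eq_iff z _ _).2 ?_
  rw [encard_highLoops, encard_highLoops]
  exact ⟨N.leUpTo_encard_highLoop_cons hv hv' h a q r,
    N.leUpTo_encard_highLoop_cons hv' hv h.symm a q r⟩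

theorem leUpTo_encard_loop_cons (hv : v ≠ []) (hv' : v' ≠ []) (hh : v.head? = v'.head?)
    (h : N.returnFunc z v = N.returnFunc z v') (h' : N.loopFunc z v = N.loopFunc z v')
    (a : A) (q r : Q) :
    LeUpTo z {s | N.Valid s (WordEnd (a :: v) r) ∅ (a :: v) q}.encard
      {s | N.Valid s (WordEnd (a :: v') r) ∅ (a :: v') q}.encard := by
  refine N.leUpTo_encard_valid_append hv hv' (N.leUpTo_of_returnFunc_eq h) ?_ (by simp) ?_ [a] q
  · intro x _ q
    simp only [WordEnd, show ∀ v : List A, x ++ v = a :: v ↔ x = [a] from fun v =>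
      List.append_left_inj (s₁ := x) (s₂ := [a]) v]
  · exact N.leUpTo_encard_valid_cons_end hh (N.leUpTo_of_loopFunc_eq h')
      (fun p => N.leUpTo_encard_highLoop_cons hv hv' h a p r)

theorem loopFunc_cons (hv : v ≠ []) (hv' : v' ≠ []) (hh : v.head? = v'.head?)
    (h : N.returnFunc z v = N.returnFunc z v') (h' : N.loopFunc z v = N.loopFunc z v') (a : A) :
    N.loopFunc z (a :: v) = N.loopFunc z (a :: v') := by
  funext ⟨q, r⟩
  refine (countUpTo_eq_iff z _ _).2 ?_
  rw [encard_loops, encard_loops]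
  exact ⟨N.leUpTo_encard_loop_cons hv hv' hh h h' a q r,
    N.leUpTo_encard_loop_cons hv' hv hh.symm h.symm h'.symm a q r⟩

theorem leUpTo_encard_wordRuns_cons (hv : v ≠ []) (hv' : v' ≠ [])
    (h : N.returnFunc z v = N.returnFunc z v') {u u' : List A} (hu : u.length ≤ v.length)
    (hu' : u'.length ≤ v'.length) {r : Q}
    (hr : ∀ q, LeUpTo z (N.wordRuns v u q r).encard (N.wordRuns v' u' q r).encard) (a : A) (q : Q) :
    LeUpTo z (N.wordRuns (a :: v) u q r).encard (N.wordRuns (a :: v') u' q r).encard := by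
  simp only [encard_wordRuns] at hr ⊢
  refine N.leUpTo_encard_valid_append hv hv' (N.leUpTo_of_returnFunc_eq h) ?_ (by simp) hr [a] q
  intro x hx q
  have hx := List.length_pos_iff.2 hx
  have h1 : x ++ v ≠ u := fun e => by
    rw [← e, List.length_append] at hu
    omega
  have h2 : x ++ v' ≠ u' := fun e => by
    rw [← e, List.length_append] at hu'
    omega
  simp [WordEnd, h1, h2]

end Cons

end PDS₂

/-! ### Equivalence of coloured successor structures up to a quantifier rank -/

section Rank

open FirstOrder Language

variable {C : Type u}

/-- Satisfaction of a formula by a tuple of elements of a coloured successor structure. -/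
def Sat (P : C → ℕ → Prop) (m : ℕ) {n : ℕ} (φ : (succLanguage C).BoundedFormula Empty n)
    (t : Fin n → Fin m) : Prop :=
  @BoundedFormula.Realize _ (Fin m) (succStructure P m) Empty n φ default t

/-- Two tuples of elements of coloured successor structures satisfy the same formulas of quantifier
rank at most `k`. -/
def RankEquiv (P P' : C → ℕ → Prop) {m m' n : ℕ} (k : ℕ) (t : Fin n → Fin m)
    (t' : Fin n → Fin m') : Prop :=
  ∀ φ : (succLanguage C).BoundedFormula Empty n, quantRank φ ≤ k → (Sat P m φ t ↔ Sat P' m' φ t')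

variable {P P' : C → ℕ → Prop} {m m' n k : ℕ} {t : Fin n → Fin m} {t' : Fin n → Fin m'}

theorem rankTheory_eq_iff :
    rankTheory (succLanguage C) (Fin m) (succStructure P m) k =
      rankTheory (succLanguage C) (Fin m') (succStructure P' m') k ↔
    RankEquiv P P' k (default : Fin 0 → Fin m) (default : Fin 0 → Fin m') := by
  simp only [Set.ext_iff, rankTheory, Set.mem_ofPred_eq, RankEquiv]
  exact forall_congr' fun φ => and_congr_right_iff

theorem RankEquiv.symm (h : RankEquiv P P' k t t') : RankEquiv P' P k t' t :=
  fun φ hφ => (h φ hφ).symm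

theorem RankEquiv.mono {l : ℕ} (h : RankEquiv P P' k t t') (hl : l ≤ k) : RankEquiv P P' l t t' :=
  fun φ hφ => h φ (hφ.trans hl)

/-- The tuples satisfy the same atomic formulas. -/
def AtomEquiv (P P' : C → ℕ → Prop) (t : Fin n → Fin m) (t' : Fin n → Fin m') : Prop :=
  (∀ i j, t i = t j ↔ t' i = t' j) ∧
    (∀ i j, (t j : ℕ) = t i + 1 ↔ (t' j : ℕ) = t' i + 1) ∧ ∀ c i, P c (t i) ↔ P' c (t' i)

theorem RankEquiv.atomEquiv (h : RankEquiv P P' k t t') : AtomEquiv P P' t t' := by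
  refine ⟨fun i j => ?_, fun i j => ?_, fun c i => ?_⟩
  · exact h (.equal (.var (.inr i)) (.var (.inr j))) (by simp [quantRank])
  · exact h (.rel (SuccRel.succ : (succLanguage C).Relations 2)
      ![.var (.inr i), .var (.inr j)]) (by simp [quantRank])
  · exact h (.rel (SuccRel.color c : (succLanguage C).Relations 1) ![.var (.inr i)])
      (by simp [quantRank])

theorem term_eq_var (s : (succLanguage C).Term (Empty ⊕ Fin n)) : ∃ i, s = .var (.inr i) := by
  cases s with
  | var x =>
    cases x with
    | inl e => exact e.elim
    | inr i => exact ⟨i, rfl⟩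
  | func f => exact Empty.elim f

theorem AtomEquiv.sat_rel_iff (h : AtomEquiv P P' t t') {l : ℕ} (R : (succLanguage C).Relations l)
    (s : Fin l → (succLanguage C).Term (Empty ⊕ Fin n)) :
    Sat P m (.rel R s) t ↔ Sat P' m' (.rel R s) t' := by
  choose i hi using fun j => term_eq_var (s j)
  obtain rfl : s = fun j => .var (.inr (i j)) := funext hi
  cases R with
  | succ => exact h.2.1 (i 0) (i 1)
  | color c => exact h.2.2 c (i 0)

theorem AtomEquiv.sat_equal_iff (h : AtomEquiv P P' t t')
    (s₁ s₂ : (succLanguage C).Term (Empty ⊕ Fin n)) :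
    Sat P m (.equal s₁ s₂) t ↔ Sat P' m' (.equal s₁ s₂) t' := by
  obtain ⟨i, rfl⟩ := term_eq_var s₁
  obtain ⟨j, rfl⟩ := term_eq_var s₂
  exact h.1 i j

theorem AtomEquiv.rankEquiv_zero (h : AtomEquiv P P' t t') : RankEquiv P P' 0 t t' := by
  intro φ
  induction φ with
  | falsum => exact fun _ => Iff.rfl
  | equal s₁ s₂ => exact fun _ => h.sat_equal_iff s₁ s₂
  | rel R s => exact fun _ => h.sat_rel_iff R s
  | imp φ ψ ih₁ ih₂ =>
    intro hr
    simp only [quantRank, Nat.le_zero, Nat.max_eq_zero_iff] at hr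
    exact imp_congr (ih₁ h hr.1.le) (ih₂ h hr.2.le)
  | all φ => intro hr; simp [quantRank] at hr

theorem AtomEquiv.rankEquiv_succ (h : AtomEquiv P P' t t')
    (forth : ∀ a, ∃ b, RankEquiv P P' k (Fin.snoc t a : Fin (n + 1) → Fin m) (Fin.snoc t' b))
    (back : ∀ b, ∃ a, RankEquiv P P' k (Fin.snoc t a : Fin (n + 1) → Fin m) (Fin.snoc t' b)) :
    RankEquiv P P' (k + 1) t t' := by
  intro φ
  induction φ with
  | falsum => exact fun _ => Iff.rfl
  | equal s₁ s₂ => exact fun _ => h.sat_equal_iff s₁ s₂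
  | rel R s => exact fun _ => h.sat_rel_iff R s
  | imp φ ψ ih₁ ih₂ =>
    intro hr
    simp only [quantRank, max_le_iff] at hr
    exact imp_congr (ih₁ h forth back hr.1) (ih₂ h forth back hr.2)
  | all φ =>
    intro hr
    simp only [quantRank, Nat.add_le_add_iff_right] at hr
    constructor
    · intro hs b
      obtain ⟨a, hab⟩ := back b
      exact (hab φ hr).1 (hs a)
    · intro hs a
      obtain ⟨b, hab⟩ := forth a
      exact (hab φ hr).2 (hs b)

/-- As the structures are finite, a conjunction of formulas suffices to describe what separates an
element from all the elements of the other structure. -/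
theorem RankEquiv.forth (h : RankEquiv P P' (k + 1) t t') (a : Fin m) :
    ∃ b, RankEquiv P P' k (Fin.snoc t a : Fin (n + 1) → Fin m) (Fin.snoc t' b) := by
  by_contra! hc
  have sep : ∀ b, ∃ φ : (succLanguage C).BoundedFormula Empty (n + 1), quantRank φ ≤ k ∧
      Sat P m φ (Fin.snoc t a : Fin (n + 1) → Fin m) ∧
      ¬ Sat P' m' φ (Fin.snoc t' b : Fin (n + 1) → Fin m') := by
    intro b
    have := hc b
    simp only [RankEquiv, not_forall] at this
    obtain ⟨φ, hr, hφ⟩ := this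
    by_cases h1 : Sat P m φ (Fin.snoc t a : Fin (n + 1) → Fin m)
    · exact ⟨φ, hr, h1, fun h2 => hφ (iff_of_true h1 h2)⟩
    · refine ⟨.imp φ .falsum, by simpa [quantRank] using hr, h1, fun h2 => ?_⟩
      exact hφ (iff_of_false h1 h2)
  have conj : ∀ l : List (Fin m'), ∃ φ : (succLanguage C).BoundedFormula Empty (n + 1),
      quantRank φ ≤ k ∧ Sat P m φ (Fin.snoc t a : Fin (n + 1) → Fin m) ∧
      ∀ b ∈ l, ¬ Sat P' m' φ (Fin.snoc t' b : Fin (n + 1) → Fin m') := by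
    intro l
    induction l with
    | nil => exact ⟨.imp .falsum .falsum, by simp [quantRank], id, by simp⟩
    | cons b l ih =>
      obtain ⟨ψ, h1, h2, h3⟩ := ih
      obtain ⟨φ, g1, g2, g3⟩ := sep b
      refine ⟨.imp (.imp φ (.imp ψ .falsum)) .falsum, by simp [quantRank, h1, g1],
        fun h => h g2 h2, ?_⟩
      intro b' hb' hs
      rcases List.mem_cons.1 hb' with rfl | hb'
      · exact hs fun h => absurd h g3
      · exact hs fun _ h => absurd h (h3 b' hb')
  obtain ⟨φ, h1, h2, h3⟩ := conj (List.finRange m')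
  refine ((h (.all (.imp φ .falsum)) (by simpa [quantRank] using h1)).2 ?_) a h2
  exact fun b hb => h3 b (List.mem_finRange b) hb

theorem RankEquiv.back (h : RankEquiv P P' (k + 1) t t') (b : Fin m') :
    ∃ a, RankEquiv P P' k (Fin.snoc t a : Fin (n + 1) → Fin m) (Fin.snoc t' b) :=
  (h.symm.forth b).imp fun _ => RankEquiv.symm

/-- The least element is definable by a formula of quantifier rank `1`. -/
theorem RankEquiv.eq_zero_iff (h : RankEquiv P P' (k + 1) t t') (i : Fin n) :
    (t i : ℕ) = 0 ↔ (t' i : ℕ) = 0 := by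
  have key : ∀ {P P' : C → ℕ → Prop} {m m' : ℕ} {t : Fin n → Fin m} {t' : Fin n → Fin m'},
      RankEquiv P P' (k + 1) t t' → (t i : ℕ) = 0 → (t' i : ℕ) = 0 := by
    intro P P' m m' t t' h h0
    by_contra hc
    obtain ⟨a, ha⟩ := h.back ⟨t' i - 1, by omega⟩
    have := (ha.atomEquiv.2.1 (Fin.last n) i.castSucc).2 (by simp; omega)
    simp [h0] at this
  exact ⟨key h, key h.symm⟩

/-- Passing to fewer colours preserves equivalence. -/
theorem RankEquiv.reduct {D : Type v} {R R' : D → ℕ → Prop} (f : D → C)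
    (hR : ∀ d i, R d i ↔ P (f d) i) (hR' : ∀ d i, R' d i ↔ P' (f d) i)
    (h : RankEquiv P P' k t t') : RankEquiv R R' k t t' := by
  induction k generalizing n with
  | zero =>
    refine AtomEquiv.rankEquiv_zero ⟨h.atomEquiv.1, h.atomEquiv.2.1, fun d i => ?_⟩
    rw [hR, hR']
    exact h.atomEquiv.2.2 _ _
  | succ k ih =>
    refine AtomEquiv.rankEquiv_succ ⟨h.atomEquiv.1, h.atomEquiv.2.1, fun d i => ?_⟩ ?_ ?_
    · rw [hR, hR']
      exact h.atomEquiv.2.2 _ _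
    · exact fun a => (h.forth a).imp fun _ => ih
    · exact fun b => (h.back b).imp fun _ => ih

theorem atomEquiv_cons_least {R R' : C → ℕ → Prop} (h0 : ∀ c, R c 0 ↔ R' c 0)
    (hs : ∀ (j : Fin m) (j' : Fin m'), (∀ c, P c j ↔ P' c j') → ∀ c, R c (j + 1) ↔ R' c (j' + 1))
    {l : ℕ} {x : Fin l → Fin (m + 1)} {x' : Fin l → Fin (m' + 1)}
    (hx : ∀ i, (x i = 0 ∧ x' i = 0) ∨ ∃ j, x i = (t j).succ ∧ x' i = (t' j).succ)
    (h : RankEquiv P P' (k + 1) t t' ∨ (∀ i, x i ≠ 0) ∧ RankEquiv P P' k t t') :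
    AtomEquiv R R' x x' := by
  have ha : AtomEquiv P P' t t' := h.elim (fun h => h.atomEquiv) (fun h => h.2.atomEquiv)
  refine ⟨fun i i' => ?_, fun i i' => ?_, fun c i => ?_⟩
  · rcases hx i with ⟨e, e'⟩ | ⟨j, e, e'⟩ <;> rcases hx i' with ⟨f, f'⟩ | ⟨j', f, f'⟩ <;>
      simp only [e, e', f, f', Fin.succ_inj, Fin.succ_ne_zero, (Fin.succ_ne_zero _).symm]
    exact ha.1 j j'
  · rcases hx i with ⟨e, e'⟩ | ⟨j, e, e'⟩ <;> rcases hx i' with ⟨f, f'⟩ | ⟨j', f, f'⟩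
    · simp [e, e', f, f']
    · rcases h with h | ⟨h, -⟩
      · simpa [e, e', f, f'] using h.eq_zero_iff j'
      · exact absurd e (h i)
    · simp [e, e', f, f']
    · simpa [e, e', f, f'] using ha.2.1 j j'
  · rcases hx i with ⟨e, e'⟩ | ⟨j, e, e'⟩
    · simpa [e, e'] using h0 c
    · simpa [e, e'] using hs (t j) (t' j) (fun c => ha.2.2 c j) c

/-- Equivalence is preserved by a new least element.  Once the new element has been chosen, the
element next to it can be told from the others by an atomic formula, but then one quantifier is left
in the old structures to define that element. -/
theorem RankEquiv.cons_least {R R' : C → ℕ → Prop} (h0 : ∀ c, R c 0 ↔ R' c 0)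
    (hs : ∀ (j : Fin m) (j' : Fin m'), (∀ c, P c j ↔ P' c j') → ∀ c, R c (j + 1) ↔ R' c (j' + 1))
    {l : ℕ} {x : Fin l → Fin (m + 1)} {x' : Fin l → Fin (m' + 1)}
    (hx : ∀ i, (x i = 0 ∧ x' i = 0) ∨ ∃ j, x i = (t j).succ ∧ x' i = (t' j).succ)
    (h : RankEquiv P P' (k + 1) t t' ∨ (∀ i, x i ≠ 0) ∧ RankEquiv P P' k t t') :
    RankEquiv R R' k x x' := by
  have atoms := atomEquiv_cons_least h0 hs hx h
  induction k generalizing n l with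
  | zero => exact atoms.rankEquiv_zero
  | succ k ih =>
    have h' : RankEquiv P P' (k + 1) t t' := h.elim (fun h => h.mono (by omega)) (fun h => h.2)
    have new : RankEquiv R R' k (Fin.snoc x 0 : Fin (l + 1) → Fin (m + 1))
        (Fin.snoc x' 0 : Fin (l + 1) → Fin (m' + 1)) := by
      have hx' : ∀ i, (Fin.snoc x 0 : Fin (l + 1) → Fin (m + 1)) i = 0 ∧
          (Fin.snoc x' 0 : Fin (l + 1) → Fin (m' + 1)) i = 0 ∨
          ∃ j, (Fin.snoc x 0 : Fin (l + 1) → Fin (m + 1)) i = (t j).succ ∧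
            (Fin.snoc x' 0 : Fin (l + 1) → Fin (m' + 1)) i = (t' j).succ := by
        refine Fin.lastCases (.inl (by simp)) fun i => ?_
        simpa using hx i
      exact ih hx' (.inl h') (atomEquiv_cons_least h0 hs hx' (.inl h'))
    have old : ∀ a b, (RankEquiv P P' (k + 1) (Fin.snoc t a : Fin (n + 1) → Fin m)
          (Fin.snoc t' b) ∨ (∀ i, x i ≠ 0) ∧
          RankEquiv P P' k (Fin.snoc t a : Fin (n + 1) → Fin m) (Fin.snoc t' b)) →
        RankEquiv R R' k (Fin.snoc x a.succ : Fin (l + 1) → Fin (m + 1))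
          (Fin.snoc x' b.succ : Fin (l + 1) → Fin (m' + 1)) := by
      intro a b hab
      have hx' : ∀ i, (Fin.snoc x a.succ : Fin (l + 1) → Fin (m + 1)) i = 0 ∧
          (Fin.snoc x' b.succ : Fin (l + 1) → Fin (m' + 1)) i = 0 ∨
          ∃ j, (Fin.snoc x a.succ : Fin (l + 1) → Fin (m + 1)) i =
              ((Fin.snoc t a : Fin (n + 1) → Fin m) j).succ ∧
            (Fin.snoc x' b.succ : Fin (l + 1) → Fin (m' + 1)) i =
              ((Fin.snoc t' b : Fin (n + 1) → Fin m') j).succ := by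
        refine Fin.lastCases (.inr ⟨Fin.last n, by simp⟩) fun i => ?_
        rcases hx i with h | ⟨j, h⟩
        · exact .inl (by simpa using h)
        · exact .inr ⟨j.castSucc, by simpa using h⟩
      have hab' := hab.imp_right fun hab => And.intro
        (show ∀ i, (Fin.snoc x a.succ : Fin (l + 1) → Fin (m + 1)) i ≠ 0 from
          Fin.lastCases (by simp [Fin.succ_ne_zero]) fun i => by simpa using hab.1 i) hab.2
      exact ih hx' hab' (atomEquiv_cons_least h0 hs hx' hab')
    refine atoms.rankEquiv_succ (fun a => ?_) (fun b => ?_)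
    · refine Fin.cases ⟨0, new⟩ (fun a => ?_) a
      rcases h with h | ⟨h, h''⟩
      · obtain ⟨b, hb⟩ := h.forth a
        exact ⟨b.succ, old a b (.inl hb)⟩
      · obtain ⟨b, hb⟩ := h''.forth a
        exact ⟨b.succ, old a b (.inr ⟨h, hb⟩)⟩
    · refine Fin.cases ⟨0, new⟩ (fun b => ?_) b
      rcases h with h | ⟨h, h''⟩
      · obtain ⟨a, ha⟩ := h.back b
        exact ⟨a.succ, old a b (.inl ha)⟩
      · obtain ⟨a, ha⟩ := h''.back b
        exact ⟨a.succ, old a b (.inr ⟨h, ha⟩)⟩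

/-! ### Finiteness of the number of types -/

variable (C) in
/-- Atomic types of `n`-tuples. -/
abbrev AtomCode (n : ℕ) : Type u :=
  (Fin n → Fin n → Prop) × (Fin n → Fin n → Prop) × (C → Fin n → Prop)

variable (C) in
/-- Codes for the rank-`k` types of `n`-tuples: the atomic type together with the set of the codes
of the extensions of the tuple by one element. -/
def TypeCode : ℕ → ℕ → Type u
  | 0, n => AtomCode C n
  | k + 1, n => AtomCode C n × Set (TypeCode k (n + 1))

theorem TypeCode.finite [Finite C] (k n : ℕ) : Finite (TypeCode C k n) := by
  induction k generalizing n with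
  | zero => exact inferInstanceAs (Finite (AtomCode C n))
  | succ k ih =>
    have := ih (n + 1)
    exact inferInstanceAs (Finite (AtomCode C n × Set (TypeCode C k (n + 1))))

/-- The atomic type of a tuple. -/
def atomCode (P : C → ℕ → Prop) {m n : ℕ} (t : Fin n → Fin m) : AtomCode C n :=
  (fun i j => t i = t j, fun i j => (t j : ℕ) = t i + 1, fun c i => P c (t i))

/-- The code of the rank-`k` type of a tuple. -/
def typeCode (P : C → ℕ → Prop) (m : ℕ) : ∀ (k : ℕ) {n : ℕ}, (Fin n → Fin m) → TypeCode C k n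
  | 0, _, t => atomCode P t
  | k + 1, n, t => (atomCode P t,
      Set.range fun a => typeCode P m k (Fin.snoc t a : Fin (n + 1) → Fin m))

theorem atomEquiv_of_atomCode_eq (h : atomCode P t = atomCode P' t') : AtomEquiv P P' t t' := by
  simp only [atomCode, Prod.mk.injEq, funext_iff, eq_iff_iff] at h
  exact h

theorem rankEquiv_of_typeCode_eq (h : typeCode P m k t = typeCode P' m' k t') :
    RankEquiv P P' k t t' := by
  induction k generalizing n with
  | zero => exact (atomEquiv_of_atomCode_eq h).rankEquiv_zero
  | succ k ih =>
    obtain ⟨h1, h2⟩ := Prod.mk.inj h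
    refine (atomEquiv_of_atomCode_eq h1).rankEquiv_succ (fun a => ?_) (fun b => ?_)
    · obtain ⟨b, hb⟩ := h2.subset ⟨a, rfl⟩
      exact ⟨b, ih hb.symm⟩
    · obtain ⟨a, ha⟩ := h2.superset ⟨b, rfl⟩
      exact ⟨a, ih ha⟩

theorem WordExpansion.typ_eq_iff {A : Type v} (E : WordExpansion.{u} A) (k : ℕ) (w w' : List A) :
    E.typ k w = E.typ k w' ↔ RankEquiv (fun c i => E.HasColor c w i) (fun c i => E.HasColor c w' i)
      k (default : Fin 0 → Fin w.length) (default : Fin 0 → Fin w'.length) :=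
  rankTheory_eq_iff

/-- Words with the same type code have the same type. -/
theorem WordExpansion.finite_range_typ {A : Type v} (E : WordExpansion.{u} A) [Finite E.Color]
    (k : ℕ) : Finite (Set.range (E.typ k)) := by
  have := TypeCode.finite (C := E.Color) k 0
  refine Finite.of_injective (β := TypeCode E.Color k 0) (fun x =>
    typeCode (fun c i => E.HasColor c x.2.choose i) x.2.choose.length k default) ?_
  intro x y h
  have := (E.typ_eq_iff k _ _).2 (rankEquiv_of_typeCode_eq h)
  rw [x.2.choose_spec, y.2.choose_spec] at this
  exact Subtype.ext this

end Rank

namespace PDS₂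

variable {Q : Type u} {A : Type v}

instance BaseColor.finite [Finite Q] [Finite A] (z : ℕ) : Finite (BaseColor Q A z) := by
  let F := Q × Q → Fin (z + 1)
  refine Finite.of_injective (β := A ⊕ (Q × Q × Fin (z + 1)) ⊕ F ⊕ F ⊕ F) (fun c => match c with
    | .letter a => .inl a
    | .runs q q' j => .inr (.inl (q, q', j))
    | .ret f => .inr (.inr (.inl f))
    | .loop f => .inr (.inr (.inr (.inl f)))
    | .highLoop f => .inr (.inr (.inr (.inr f)))) ?_
  intro c c' h
  cases c <;> cases c' <;> simp_all

theorem finite_color_lin [Finite Q] [Finite A] (N : PDS₂ Q A) (k z n : ℕ) :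
    Finite (N.lin k z n).Color := by
  induction n with
  | zero => exact BaseColor.finite z
  | succ n ih =>
    have := (N.lin k z n).finite_range_typ k
    exact inferInstanceAs (Finite ((N.lin k z n).Color ⊕ Set.range ((N.lin k z n).typ k)))

theorem finite_wordClasses [Finite Q] [Finite A] (N : PDS₂ Q A) (n z : ℕ) :
    Finite (N.WordClasses n z) := by
  have := N.finite_color_lin z z n
  have := (N.lin z z n).finite_range_typ z
  exact Finite.of_equiv _ (Setoid.quotientKerEquivRange ((N.lin z z n).typ z)).symm

/-! ### The equivalence of words is a congruence -/

/-- As words are coloured from the top, the colours at position `0` are those of the whole word, and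
position `0` is definable. -/
theorem hasColor_zero_iff {E : WordExpansion.{u} A} {z : ℕ} (hz : 2 ≤ z) {w w' : List A}
    (hw : w ≠ []) (h : E.typ z w = E.typ z w') (c : E.Color) :
    E.HasColor c w 0 ↔ E.HasColor c w' 0 := by
  have h := ((E.typ_eq_iff z w w').1 h).mono hz
  obtain ⟨b, hb⟩ := h.forth ⟨0, List.length_pos_iff.2 hw⟩
  have h0 := hb.eq_zero_iff (Fin.last 0)
  have hc := hb.atomEquiv.2.2 c (Fin.last 0)
  simp only [Fin.snoc_last, true_iff] at h0 hc
  rwa [h0] at hc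

theorem WordEquiv.of_succ {N : PDS₂ Q A} {n z : ℕ} {w w' : List A}
    (h : N.WordEquiv (n + 1) z w w') : N.WordEquiv n z w w' := by
  have := ((N.lin z z (n + 1)).typ_eq_iff z w w').1 h
  exact ((N.lin z z n).typ_eq_iff z w w').2
    (this.reduct (P := fun c i => (N.lin z z (n + 1)).HasColor c w i)
      (P' := fun c i => (N.lin z z (n + 1)).HasColor c w' i) Sum.inl
      (fun d i => Iff.rfl) (fun d i => Iff.rfl))

theorem WordEquiv.zero_level {N : PDS₂ Q A} {z : ℕ} {w w' : List A} :
    ∀ {n : ℕ}, N.WordEquiv n z w w' → N.WordEquiv 0 z w w'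
  | 0, h => h
  | _ + 1, h => h.of_succ.zero_level

theorem WordEquiv.hasColor_zero_iff {N : PDS₂ Q A} {n z : ℕ} (hz : 2 ≤ z) {w w' : List A}
    (hw : w ≠ []) (h : N.WordEquiv n z w w') (c : BaseColor Q A z) :
    (N.baseExpansion z).HasColor c w 0 ↔ (N.baseExpansion z).HasColor c w' 0 :=
  PDS₂.hasColor_zero_iff (E := N.baseExpansion z) hz hw h.zero_level c

theorem WordEquiv.ne_nil {N : PDS₂ Q A} {n z : ℕ} (hz : 2 ≤ z) {w w' : List A}
    (hw : w ≠ []) (h : N.WordEquiv n z w w') : w' ≠ [] := by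
  have h := ((WordExpansion.typ_eq_iff _ z w w').1 h).mono hz
  obtain ⟨b, -⟩ := h.forth ⟨0, List.length_pos_iff.2 hw⟩
  exact List.length_pos_iff.1 b.pos

section Facts

variable {N : PDS₂ Q A} {n z : ℕ} {w w' : List A}

theorem WordEquiv.head?_eq (hz : 2 ≤ z) (hw : w ≠ []) (h : N.WordEquiv n z w w') :
    w.head? = w'.head? := by
  obtain ⟨a, w, rfl⟩ := List.exists_cons_of_ne_nil hw
  have := (h.hasColor_zero_iff hz hw (.letter a)).1 (by simp [baseExpansion])
  simpa [baseExpansion, eq_comm] using this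

theorem WordEquiv.returnFunc_eq (hz : 2 ≤ z) (hw : w ≠ []) (h : N.WordEquiv n z w w') :
    N.returnFunc z w = N.returnFunc z w' := by
  have := (h.hasColor_zero_iff hz hw (.ret (N.returnFunc z w))).1 (by simp [baseExpansion])
  simpa [baseExpansion, eq_comm] using this

theorem WordEquiv.loopFunc_eq (hz : 2 ≤ z) (hw : w ≠ []) (h : N.WordEquiv n z w w') :
    N.loopFunc z w = N.loopFunc z w' := by
  have := (h.hasColor_zero_iff hz hw (.loop (N.loopFunc z w))).1 (by simp [baseExpansion])
  simpa [baseExpansion, eq_comm] using this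

end Facts

theorem leUpTo_wordRuns_self (N : PDS₂ Q A) {z : ℕ} {w w' : List A}
    (h : N.loopFunc z w = N.loopFunc z w') (q q' : Q) :
    LeUpTo z (N.wordRuns w w q q').encard (N.wordRuns w' w' q q').encard := by
  rw [encard_wordRuns, encard_wordRuns]
  exact N.leUpTo_of_loopFunc_eq h q q'

section Cons

variable [Finite Q] [Finite A] (N : PDS₂ Q A) {n z : ℕ} {v v' : List A}

theorem baseExpansion_hasColor_cons_zero (hz : 2 ≤ z) (hv : v ≠ []) (h : N.WordEquiv n z v v')
    (a : A) (c : BaseColor Q A z) : (N.baseExpansion z).HasColor c (a :: v) 0 ↔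
      (N.baseExpansion z).HasColor c (a :: v') 0 := by
  have hv' := h.ne_nil hz hv
  have hret := h.returnFunc_eq hz hv
  have hloop := N.loopFunc_cons hv hv' (h.head?_eq hz hv) hret (h.loopFunc_eq hz hv) a
  cases c with
  | letter b => simp [baseExpansion]
  | runs q q' j =>
    exact ⟨natCast_le_of_leUpTo (N.leUpTo_wordRuns_self hloop q q') j,
      natCast_le_of_leUpTo (N.leUpTo_wordRuns_self hloop.symm q q') j⟩
  | ret f => simp [baseExpansion, N.returnFunc_cons hv hv' hret a]
  | loop f => simp [baseExpansion, hloop]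
  | highLoop f => simp [baseExpansion, N.highLoopFunc_cons hv hv' hret a]

theorem baseExpansion_hasColor_cons_succ (hz : 2 ≤ z) (hv : v ≠ []) (h : N.WordEquiv n z v v')
    (a : A) (j j' : ℕ)
    (hc : ∀ c, (N.baseExpansion z).HasColor c v j ↔ (N.baseExpansion z).HasColor c v' j')
    (c : BaseColor Q A z) : (N.baseExpansion z).HasColor c (a :: v) (j + 1) ↔
      (N.baseExpansion z).HasColor c (a :: v') (j' + 1) := by
  have hv' := h.ne_nil hz hv
  have hret := h.returnFunc_eq hz hv
  cases c with
  | letter b => simpa [baseExpansion] using hc (.letter b)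
  | runs q q' i =>
    have h1 : ∀ q, LeUpTo z (N.wordRuns v (v.drop j) q q').encard
        (N.wordRuns v' (v'.drop j') q q').encard := fun q =>
      leUpTo_of_forall_natCast_le fun i => (hc (.runs q q' i)).1
    have h2 : ∀ q, LeUpTo z (N.wordRuns v' (v'.drop j') q q').encard
        (N.wordRuns v (v.drop j) q q').encard := fun q =>
      leUpTo_of_forall_natCast_le fun i => (hc (.runs q q' i)).2
    exact ⟨natCast_le_of_leUpTo (N.leUpTo_encard_wordRuns_cons hv hv' hret (by simp) (by simp)
        h1 a q) i,
      natCast_le_of_leUpTo (N.leUpTo_encard_wordRuns_cons hv' hv hret.symm (by simp) (by simp)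
        h2 a q) i⟩
  | ret f => simpa [baseExpansion] using hc (.ret f)
  | loop f => simpa [baseExpansion] using hc (.loop f)
  | highLoop f => simpa [baseExpansion] using hc (.highLoop f)

/-- The colours of level `n + 1` at the new position are determined by the types of level `n`, so
that the statements on the types and on the colours are proved simultaneously. -/
theorem wordEquiv_cons_aux (hz : 2 ≤ z) (hv : v ≠ []) (a : A) : ∀ {n : ℕ}, N.WordEquiv n z v v' →
    (∀ c, (N.lin z z n).HasColor c (a :: v) 0 ↔ (N.lin z z n).HasColor c (a :: v') 0) ∧
    (∀ j j' : ℕ, (∀ c, (N.lin z z n).HasColor c v j ↔ (N.lin z z n).HasColor c v' j') →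
      ∀ c, (N.lin z z n).HasColor c (a :: v) (j + 1) ↔
        (N.lin z z n).HasColor c (a :: v') (j' + 1)) ∧
    N.WordEquiv n z (a :: v) (a :: v') := by
  have step : ∀ n, N.WordEquiv n z v v' →
      (∀ c, (N.lin z z n).HasColor c (a :: v) 0 ↔ (N.lin z z n).HasColor c (a :: v') 0) →
      (∀ j j' : ℕ, (∀ c, (N.lin z z n).HasColor c v j ↔ (N.lin z z n).HasColor c v' j') →
        ∀ c, (N.lin z z n).HasColor c (a :: v) (j + 1) ↔
          (N.lin z z n).HasColor c (a :: v') (j' + 1)) →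
      N.WordEquiv n z (a :: v) (a :: v') := by
    intro n h h0 hs
    have := ((N.lin z z n).typ_eq_iff z v v').1 h
    refine ((N.lin z z n).typ_eq_iff z _ _).2 ?_
    exact RankEquiv.cons_least h0 (fun j j' => hs j j') (fun i => i.elim0)
      (.inr ⟨fun i => i.elim0, this⟩)
  intro n
  induction n with
  | zero =>
    intro h
    have h0 := N.baseExpansion_hasColor_cons_zero hz hv h a
    have hs := N.baseExpansion_hasColor_cons_succ hz hv h a
    exact ⟨h0, hs, step 0 h h0 hs⟩
  | succ n ih =>
    intro h
    obtain ⟨i0, is, it⟩ := ih h.of_succ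
    have h0 : ∀ c, (N.lin z z (n + 1)).HasColor c (a :: v) 0 ↔
        (N.lin z z (n + 1)).HasColor c (a :: v') 0 := by
      rintro (c | θ)
      · exact i0 c
      · exact Eq.congr_left it
    have hs : ∀ j j' : ℕ, (∀ c, (N.lin z z (n + 1)).HasColor c v j ↔
        (N.lin z z (n + 1)).HasColor c v' j') → ∀ c,
        (N.lin z z (n + 1)).HasColor c (a :: v) (j + 1) ↔
          (N.lin z z (n + 1)).HasColor c (a :: v') (j' + 1) := by
      rintro j j' hc (c | θ)
      · exact is j j' (fun c => hc (.inl c)) c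
      · exact hc (.inr θ)
    exact ⟨h0, hs, step (n + 1) h h0 hs⟩

/-- Equivalence of words is preserved by putting letters on top. -/
theorem WordEquiv.append {N : PDS₂ Q A} {n z : ℕ} {v v' : List A} (hz : 2 ≤ z) (hv : v ≠ [])
    (h : N.WordEquiv n z v v') (x : List A) : N.WordEquiv n z (x ++ v) (x ++ v') := by
  induction x with
  | nil => exact h
  | cons a x ih => exact (N.wordEquiv_cons_aux hz (by simp [hv]) a ih).2.2

end Cons

/-! ### Reachable configurations -/

/-- There is a return of `w` from `q` to `q'`. -/
def HasReturn (N : PDS₂ Q A) (w : List A) (q q' : Q) : Prop :=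
  ∃ s, N.Valid s (N.RetEnd q') ∅ w q

theorem WordEquiv.hasReturn {N : PDS₂ Q A} {n z : ℕ} (hz : 2 ≤ z) {w w' : List A} (hw : w ≠ [])
    (h : N.WordEquiv n z w w') {q q' : Q} (hr : N.HasReturn w q q') : N.HasReturn w' q q' := by
  have h1 : ({s | N.Valid s (N.RetEnd q') ∅ w q}.encard) ≠ 0 :=
    Set.encard_ne_zero.2 hr
  suffices h2 : ({s | N.Valid s (N.RetEnd q') ∅ w' q}.encard) ≠ 0 from Set.encard_ne_zero.1 h2
  intro h2
  rcases N.leUpTo_of_returnFunc_eq (h.returnFunc_eq hz hw) q q' with h3 | h3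
  · rw [h2] at h3
    exact h1 (le_antisymm h3 zero_le)
  · rw [h2] at h3
    have : z ≤ 0 := by exact_mod_cast h3
    omega

theorem WordEquiv.enabled {N : PDS₂ Q A} {n z : ℕ} (hz : 2 ≤ z) {w w' : List A} (hw : w ≠ [])
    (h : N.WordEquiv n z w w') {q p : Q} {op : StackOp N.bot} (he : N.Enabled q w p op) :
    N.Enabled q w' p op :=
  (N.enabled_congr (h.head?_eq hz hw) q p op).1 he

/-- The configurations that are reachable by runs in which returns are contracted to loops of the
topmost word; thus words other than the topmost one are never removed. -/
inductive Good (N : PDS₂ Q A) : Q → List (List A) → Prop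
  | init : Good N N.init [[N.bot]]
  | push {q p : Q} {w : List A} {t : List (List A)} {a : A} {h : a ≠ N.bot} :
      Good N q (w :: t) → N.Enabled q w p (.push a h) → Good N p ((a :: w) :: t)
  | pop {q p : Q} {w : List A} {t : List (List A)} :
      Good N q (w :: t) → w.tail ≠ [] → N.Enabled q w p .pop₁ → Good N p (w.tail :: t)
  | loop {q p r : Q} {w : List A} {t : List (List A)} :
      Good N q (w :: t) → N.Enabled q w p .clone₂ → N.HasReturn w p r → Good N r (w :: t)
  | clone {q p : Q} {w : List A} {t : List (List A)} :
      Good N q (w :: t) → N.Enabled q w p .clone₂ → Good N p (w :: w :: t)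

/-- A contracted run to a stack `w :: u :: t` has visited `u :: t` immediately before it has cloned
`u` for the last time.  Its part after this visit does not depend on `t`, and it is the beginning of
a return of `u`. -/
theorem Good.exists_clone {N : PDS₂ Q A} {q : Q} {w u : List A} {t : List (List A)}
    (h : N.Good q (w :: u :: t)) :
    ∃ p p', N.Good p (u :: t) ∧ N.Enabled p u p' .clone₂ ∧
      (∀ r, N.HasReturn w q r → N.HasReturn u p' r) ∧
      ∀ t', N.Good p (u :: t') → N.Good q (w :: u :: t') := by
  generalize hs : w :: u :: t = s at h
  induction h generalizing w with
  | init => simp at hs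
  | @push q q' w' t' a ha hg he ih =>
    simp only [List.cons.injEq] at hs
    obtain ⟨rfl, rfl⟩ := hs
    obtain ⟨p, p', h1, h2, h3, h4⟩ := ih rfl
    refine ⟨p, p', h1, h2, fun r ⟨s, hs⟩ => h3 r ⟨.push a q' s, ⟨by simp, ha, he⟩, hs⟩,
      fun t' h => (h4 t' h).push he⟩
  | @pop q q' w' t' hg hw he ih =>
    simp only [List.cons.injEq] at hs
    obtain ⟨rfl, rfl⟩ := hs
    obtain ⟨p, p', h1, h2, h3, h4⟩ := ih rfl
    refine ⟨p, p', h1, h2, fun r ⟨s, hs⟩ => h3 r ⟨.pop q' s, ⟨by simp, hw, he⟩, hs⟩,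
      fun t' h => (h4 t' h).pop hw he⟩
  | @loop q q' q'' w' t' hg he hr ih =>
    simp only [List.cons.injEq] at hs
    obtain ⟨rfl, rfl⟩ := hs
    obtain ⟨p, p', h1, h2, h3, h4⟩ := ih rfl
    obtain ⟨s₁, hs₁⟩ := hr
    refine ⟨p, p', h1, h2,
      fun r ⟨s, hs⟩ => h3 r ⟨.clone q' q'' s₁ s, ⟨by simp, he⟩, hs₁, hs⟩,
      fun t' h => (h4 t' h).loop he ⟨s₁, hs₁⟩⟩
  | @clone q q' w' t' hg he ih =>
    simp only [List.cons.injEq] at hs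
    obtain ⟨rfl, rfl, rfl⟩ := hs
    exact ⟨q, q', hg, he, fun r h => h, fun t' h => h.clone he⟩

theorem Good.exists_eq_cons {N : PDS₂ Q A} {q : Q} {s : List (List A)} (h : N.Good q s) :
    ∃ w t, s = w :: t := by
  cases h <;> simp

theorem Good.step {N : PDS₂ Q A} {q p : Q} {s s' : List (List A)} (h : N.Good q s)
    (hs : N.Step (q, s) (p, s')) : N.Good p s' := by
  obtain ⟨w, t, rfl⟩ := h.exists_eq_cons
  rcases (N.step_iff _ _ _ _).1 hs with ⟨a, ha, he, rfl⟩ | ⟨hw, he, rfl⟩ | ⟨he, rfl⟩ | ⟨ht, he, rfl⟩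
  · exact h.push he
  · exact h.pop hw he
  · exact h.clone he
  · obtain ⟨u, t, rfl⟩ := List.exists_cons_of_ne_nil ht
    obtain ⟨r, r', h1, h2, h3, -⟩ := h.exists_clone
    exact h1.loop h2 (h3 p ⟨.leaf, by simp, he⟩)

theorem reflTransGen_step_of_valid {N : PDS₂ Q A} (s : RunTree Q A) :
    ∀ {w : List A} {q r : Q} {t : List (List A)}, t ≠ [] → N.Valid s (N.RetEnd r) ∅ w q →
      Relation.ReflTransGen N.Step (q, w :: t) (r, t) := by
  induction s with
  | leaf =>
    rintro w q r t ht ⟨-, h⟩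
    exact .single ((N.step_iff _ _ _ _).2 (.inr (.inr (.inr ⟨ht, h, rfl⟩))))
  | push a p s ih =>
    rintro w q r t ht ⟨⟨-, h, he⟩, h'⟩
    exact .head ((N.step_iff _ _ _ _).2 (.inl ⟨a, h, he, rfl⟩)) (ih ht h')
  | pop p s ih =>
    rintro w q r t ht ⟨⟨-, h, he⟩, h'⟩
    exact .head ((N.step_iff _ _ _ _).2 (.inr (.inl ⟨h, he, rfl⟩))) (ih ht h')
  | clone p r' s₁ s₂ ih₁ ih₂ =>
    rintro w q r t ht ⟨⟨-, he⟩, h₁, h₂⟩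
    exact .head ((N.step_iff _ _ _ _).2 (.inr (.inr (.inl ⟨he, rfl⟩))))
      ((ih₁ (by simp) h₁).trans (ih₂ ht h₂))

/-- Contracted runs and runs reach the same configurations. -/
theorem good_iff (N : PDS₂ Q A) (q : Q) (s : List (List A)) :
    N.Good q s ↔ ∃ ρ, N.IsRun ρ N.initConf (q, s) := by
  constructor
  · intro h
    have key : Relation.ReflTransGen N.Step N.initConf (q, s) := by
      induction h with
      | init => exact .refl
      | push _ he ih => exact ih.tail ((N.step_iff _ _ _ _).2 (.inl ⟨_, _, he, rfl⟩))
      | pop _ hw he ih => exact ih.tail ((N.step_iff _ _ _ _).2 (.inr (.inl ⟨hw, he, rfl⟩)))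
      | loop _ he hr ih =>
        obtain ⟨s, hs⟩ := hr
        exact (ih.tail ((N.step_iff _ _ _ _).2 (.inr (.inr (.inl ⟨he, rfl⟩))))).trans
          (reflTransGen_step_of_valid s (by simp) hs)
      | clone _ he ih =>
        exact ih.tail ((N.step_iff _ _ _ _).2 (.inr (.inr (.inl ⟨he, rfl⟩))))
    obtain ⟨l, hl, hch, hh, hlast⟩ := List.exists_isChain_ne_nil_of_relationReflTransGen key
    exact ⟨l, hch, by rw [← hh, List.head?_eq_some_head],
      by rw [← hlast, List.getLast?_eq_some_getLast]⟩
  · rintro ⟨ρ, hch, hh, hl⟩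
    have hne : ρ ≠ [] := by rintro rfl; simp at hh
    have key := List.relationReflTransGen_of_exists_isChain ρ hch hne
    rw [List.head?_eq_some_head hne, Option.some.injEq] at hh
    rw [List.getLast?_eq_some_getLast hne, Option.some.injEq] at hl
    rw [hh, hl] at key
    have : ∀ {c}, Relation.ReflTransGen N.Step N.initConf c → N.Good c.1 c.2 := by
      intro c hc
      induction hc with
      | refl => exact .init
      | tail _ hs ih => exact ih.step hs
    exact this key

/-! ### Contracted runs above a word -/

/-- `N.Hill h w p r`: from state `p` and topmost word `w` there is a contracted run to `r` and `w`
whose topmost words are all of the form `x ++ w` with `|x| ≤ h`. -/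
def Hill (N : PDS₂ Q A) : ℕ → List A → Q → Q → Prop
  | 0, _ => Eq
  | h + 1, w => Relation.ReflTransGen fun p r =>
      N.Enabled p w r .clone₂ ∨ (∃ p', N.Enabled p w p' .clone₂ ∧ N.HasReturn w p' r) ∨
      ∃ a ha p₁ p₂, N.Enabled p w p₁ (.push a ha) ∧ Hill N h (a :: w) p₁ p₂ ∧
        N.Enabled p₂ (a :: w) r .pop₁

theorem Hill.succ {N : PDS₂ Q A} {h : ℕ} {w : List A} {p r : Q} (hb : N.Hill h w p r) :
    N.Hill (h + 1) w p r := by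
  induction h generalizing w p r with
  | zero => cases hb; exact .refl
  | succ h ih =>
    refine Relation.ReflTransGen.mono ?_ _ _ hb
    rintro p r (h | h | ⟨a, ha, p₁, p₂, h1, h2, h3⟩)
    · exact .inl h
    · exact .inr (.inl h)
    · exact .inr (.inr ⟨a, ha, p₁, p₂, h1, ih h2, h3⟩)

theorem Hill.mono {N : PDS₂ Q A} {h h' : ℕ} (hh : h ≤ h') {w : List A} {p r : Q}
    (hb : N.Hill h w p r) : N.Hill h' w p r := by
  induction h', hh using Nat.le_induction with
  | base => exact hb
  | succ h' _ ih => exact ih.succ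

theorem WordEquiv.hill [Finite Q] [Finite A] {N : PDS₂ Q A} {n z : ℕ} (hz : 2 ≤ z) {h : ℕ}
    {w w' : List A} (hw : w ≠ []) (hww : N.WordEquiv n z w w') {p r : Q} (hb : N.Hill h w p r) :
    N.Hill h w' p r := by
  induction h generalizing w w' p r with
  | zero => exact hb
  | succ h ih =>
    refine Relation.ReflTransGen.mono ?_ _ _ hb
    rintro p r (h | ⟨p', h, h'⟩ | ⟨a, ha, p₁, p₂, h1, h2, h3⟩)
    · exact .inl (hww.enabled hz hw h)
    · exact .inr (.inl ⟨p', hww.enabled hz hw h, hww.hasReturn hz hw h'⟩)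
    · have := hww.append hz hw [a]
      exact .inr (.inr ⟨a, ha, p₁, p₂, hww.enabled hz hw h1, ih (by simp) this h2,
        this.enabled hz (by simp) h3⟩)

/-- The relations `Hill h w` only depend on the class of `w`, they grow with `h`, and once they
have not grown for any class, they will never grow again. -/
theorem Hill.boundHeight [Finite Q] [Finite A] {N : PDS₂ Q A} {h : ℕ} {w : List A} (hw : w ≠ [])
    {p r : Q} (hb : N.Hill h w p r) : N.Hill N.boundHeight w p r := by
  have := N.finite_wordClasses 0 2
  set B : ℕ → Set (Q × Q × N.WordClasses 0 2) := fun h =>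
    {x | ∃ w ≠ [], Quotient.mk (N.wordSetoid 0 2) w = x.2.2 ∧ N.Hill h w x.1 x.2.1} with hB
  have hmem : ∀ {h w p r}, w ≠ [] →
      ((p, r, Quotient.mk (N.wordSetoid 0 2) w) ∈ B h ↔ N.Hill h w p r) := by
    intro h w p r hw
    refine ⟨?_, fun hb => ⟨w, hw, rfl, hb⟩⟩
    rintro ⟨w', hw', e, hb⟩
    exact WordEquiv.hill (n := 0) le_rfl hw' (Quotient.exact e) hb
  have hmono : ∀ h, B h ⊆ B (h + 1) := by
    rintro h ⟨p, r, c⟩ ⟨w, hw, e, hb⟩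
    exact ⟨w, hw, e, hb.succ⟩
  have hstep : ∀ h, B h = B (h + 1) → B (h + 1) = B (h + 2) := by
    intro h e
    refine (hmono _).antisymm ?_
    rintro ⟨p, r, c⟩ ⟨w, hw, e', hb⟩
    refine ⟨w, hw, e', Relation.ReflTransGen.mono ?_ _ _ hb⟩
    rintro p r (h | h | ⟨a, ha, p₁, p₂, h1, h2, h3⟩)
    · exact .inl h
    · exact .inr (.inl h)
    · refine .inr (.inr ⟨a, ha, p₁, p₂, h1, ?_, h3⟩)
      rw [← hmem (by simp), e]
      exact (hmem (by simp)).2 h2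
  have heq : ∀ h h', B h ⊆ B h' → (B h).ncard = (B h').ncard → B h = B h' := fun h h' hs e =>
    Set.eq_of_subset_of_ncard_le hs e.ge (Set.toFinite _)
  have hcard : ∀ h, (B h).ncard ≤ N.boundHeight := by
    intro h
    refine (Set.ncard_le_card _).trans_eq ?_
    rw [Nat.card_prod, Nat.card_prod, PDS₂.boundHeight]
    ring
  have hmono' : ∀ {h h'}, h ≤ h' → B h ⊆ B h' := fun hh => monotone_nat_of_le_succ hmono hh
  have hst := Nat.stabilises_of_monotone (f := fun h => (B h).ncard) (b := N.boundHeight)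
    (n := max h N.boundHeight)
    (fun h h' hh => Set.ncard_le_ncard (hmono' hh) (Set.toFinite _)) hcard
    (fun h e => by rw [hstep h (heq _ _ (hmono h) e)]) (le_max_right _ _)
  rw [← hmem hw, heq _ _ (hmono' (le_max_right h _)) hst.symm, hmem hw]
  exact hb.mono (le_max_left _ _)

/-- `N.Ladder v p q x`: from state `p` and topmost word `v` there is a contracted run to `q` and
`x ++ v` that stays above `v`, decomposed at its last visits to the words between. -/
inductive Ladder (N : PDS₂ Q A) (v : List A) (p : Q) : Q → List A → Prop
  | refl : Ladder N v p p []
  | push {q r : Q} {x : List A} {a : A} {h : a ≠ N.bot} :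
      Ladder N v p q x → N.Enabled q (x ++ v) r (.push a h) → Ladder N v p r (a :: x)
  | hill {q r : Q} {x : List A} {h : ℕ} :
      Ladder N v p q x → N.Hill h (x ++ v) q r → Ladder N v p r x

theorem Ladder.pop {N : PDS₂ Q A} {v : List A} {p q r : Q} {a : A} {x : List A}
    (hl : N.Ladder v p q (a :: x)) (he : N.Enabled q (a :: (x ++ v)) r .pop₁) :
    N.Ladder v p r x := by
  have key : ∃ h ha p₁ p₂, N.Ladder v p p₁ x ∧ N.Enabled p₁ (x ++ v) p₂ (.push a ha) ∧
      N.Hill h (a :: (x ++ v)) p₂ q := by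
    clear he
    generalize hy : a :: x = y at hl
    induction hl with
    | refl => simp at hy
    | @push q r x' a' ha hl he ih =>
      obtain ⟨rfl, rfl⟩ := List.cons.inj hy
      exact ⟨0, ha, q, r, hl, he, rfl⟩
    | @hill q r x' h hl hb ih =>
      subst hy
      obtain ⟨h', ha, p₁, p₂, h1, h2, h3⟩ := ih rfl
      refine ⟨max h h' + 1, ha, p₁, p₂, h1, h2, ?_⟩
      exact Relation.ReflTransGen.trans (h3.mono ((le_max_right h h').trans (Nat.le_succ _)))
        (hb.mono ((le_max_left h h').trans (Nat.le_succ _)))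
  obtain ⟨h, ha, p₁, p₂, h1, h2, h3⟩ := key
  exact h1.hill (h := h + 1) (.single (.inr (.inr ⟨a, ha, p₂, q, h2, h3, he⟩)))

theorem Ladder.trans {N : PDS₂ Q A} {v y x : List A} {p r q : Q} (h1 : N.Ladder v p r y)
    (h2 : N.Ladder (y ++ v) r q x) : N.Ladder v p q (x ++ y) := by
  induction h2 with
  | refl => exact h1
  | push _ he ih => exact ih.push (by simpa using he)
  | hill _ hb ih => exact ih.hill (by simpa using hb)

theorem Ladder.split {N : PDS₂ Q A} {v : List A} {p q : Q} {y x : List A}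
    (hl : N.Ladder v p q (x ++ y)) : ∃ r, N.Ladder v p r y ∧ N.Ladder (y ++ v) r q x := by
  generalize hz : x ++ y = z at hl
  induction hl generalizing x with
  | refl =>
    obtain ⟨rfl, rfl⟩ := List.append_eq_nil_iff.1 hz
    exact ⟨p, .refl, .refl⟩
  | @push q r x' a' ha hl he ih =>
    cases x with
    | nil =>
      obtain rfl : y = a' :: x' := by simpa using hz
      exact ⟨r, hl.push he, .refl⟩
    | cons b x =>
      obtain ⟨rfl, rfl⟩ := List.cons.inj hz
      obtain ⟨r', h1, h2⟩ := ih rfl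
      exact ⟨r', h1, h2.push (by simpa using he)⟩
  | @hill q r x' h hl hb ih =>
    obtain ⟨r', h1, h2⟩ := ih hz
    subst hz
    exact ⟨r', h1, h2.hill (by simpa using hb)⟩

theorem WordEquiv.ladder [Finite Q] [Finite A] {N : PDS₂ Q A} {n z : ℕ} (hz : 2 ≤ z)
    {v v' : List A} (hv : v ≠ []) (h : N.WordEquiv n z v v') {p q : Q} {x : List A}
    (hl : N.Ladder v p q x) : N.Ladder v' p q x := by
  induction hl with
  | refl => exact .refl
  | @push q r x a ha hl he ih =>
    exact ih.push ((h.append hz hv x).enabled hz (by simp [hv]) he)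
  | @hill q r x k hl hb ih =>
    exact ih.hill ((h.append hz hv x).hill hz (by simp [hv]) hb)

/-- The last letter of a word cannot be popped, so every reachable topmost word ends in the bottom
symbol, and its decomposition at the last visits to its suffixes starts with the word `[bot]`. -/
theorem Good.exists_ladder {N : PDS₂ Q A} {q : Q} {s : List (List A)} (h : N.Good q s) :
    ∃ x, topWord s = x ++ [N.bot] ∧ N.Ladder [N.bot] N.init q x := by
  induction h with
  | init => exact ⟨[], rfl, .refl⟩
  | @push q p w t a ha hg he ih =>
    obtain ⟨x, rfl : w = _, hx⟩ := ih
    exact ⟨a :: x, rfl, hx.push he⟩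
  | @pop q p w t hg hw he ih =>
    obtain ⟨x, rfl : w = _, hx⟩ := ih
    cases x with
    | nil => simp at hw
    | cons a x => exact ⟨x, rfl, hx.pop he⟩
  | @loop q p r w t hg he hr ih =>
    obtain ⟨x, rfl : w = _, hx⟩ := ih
    exact ⟨x, rfl, hx.hill (h := 1) (.single (.inr (.inl ⟨p, he, hr⟩)))⟩
  | @clone q p w t hg he ih =>
    obtain ⟨x, rfl : w = _, hx⟩ := ih
    exact ⟨x, rfl, hx.hill (h := 1) (.single (.inl he))⟩

/-- Contracted runs above `w` only store words that are not longer than the words they visit. -/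
theorem Hill.good {N : PDS₂ Q A} {b : ℕ} {h : ℕ} : ∀ {w : List A} {p r : Q} {t : List (List A)},
    N.Hill h w p r → w.length + h ≤ b → N.Good p (w :: t) → (∀ u ∈ t, u.length ≤ b) →
    ∃ t', N.Good r (w :: t') ∧ ∀ u ∈ t', u.length ≤ b := by
  induction h with
  | zero => rintro w p r t rfl _ hg ht; exact ⟨t, hg, ht⟩
  | succ h ih =>
    intro w p r t hb hw hg ht
    induction hb with
    | refl => exact ⟨t, hg, ht⟩
    | tail _ hs ih' =>
      obtain ⟨t', hg', ht'⟩ := ih'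
      rcases hs with he | ⟨p', he, hr⟩ | ⟨a, ha, p₁, p₂, h1, h2, h3⟩
      · refine ⟨w :: t', hg'.clone he, ?_⟩
        simpa using ⟨by omega, ht'⟩
      · exact ⟨t', hg'.loop he hr, ht'⟩
      · obtain ⟨t'', hg'', ht''⟩ := ih h2 (by simp; omega) (hg'.push h1) ht'
        obtain ⟨c, hc, -⟩ := h1
        have hne : w ≠ [] := by rintro rfl; simp at hc
        exact ⟨t'', hg''.pop (w := a :: w) hne h3, ht''⟩

/-- Every reachable topmost word is reachable with a stack of bounded height. -/
theorem Ladder.good [Finite Q] [Finite A] {N : PDS₂ Q A} {q : Q} {x : List A}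
    (hl : N.Ladder [N.bot] N.init q x) : ∃ t, N.Good q ((x ++ [N.bot]) :: t) ∧
      ∀ u ∈ t, u.length ≤ (x ++ [N.bot]).length + N.boundHeight := by
  induction hl with
  | refl => exact ⟨[], .init, by simp⟩
  | @push q r x a ha hl he ih =>
    obtain ⟨t, hg, ht⟩ := ih
    exact ⟨t, hg.push he, fun u hu => (ht u hu).trans (by simp)⟩
  | @hill q r x k hl hb ih =>
    obtain ⟨t, hg, ht⟩ := ih
    exact (hb.boundHeight (by simp)).good le_rfl hg ht

/-! ### Pumping -/

/-- Two suffixes of the topmost word that are close to the top, equivalent, and last visited in the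
same state, can be exchanged for each other, which shortens the topmost word. -/
theorem Ladder.exists_shorter [Finite Q] [Finite A] {N : PDS₂ Q A} {n z : ℕ} (hz : 2 ≤ z) {q : Q}
    {x : List A} (hl : N.Ladder [N.bot] N.init q x)
    (hx : N.boundTopWord n z < (x ++ [N.bot]).length) :
    ∃ x', N.Ladder [N.bot] N.init q x' ∧ x'.length < x.length ∧
      x.length ≤ x'.length + N.boundTopWord n z ∧
      N.WordEquiv n z (x ++ [N.bot]) (x' ++ [N.bot]) := by
  have := N.finite_wordClasses n z
  have hd : ∀ i : Fin (N.boundTopWord n z), ∃ r, N.Ladder [N.bot] N.init r (x.drop i) ∧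
      N.Ladder (x.drop i ++ [N.bot]) r q (x.take i) := fun i =>
    Ladder.split (by rwa [List.take_append_drop])
  choose r hr₁ hr₂ using hd
  have hlen : N.boundTopWord n z ≤ x.length := by
    rw [List.length_append, List.length_singleton] at hx
    omega
  obtain ⟨i, j, hne, he⟩ : ∃ i j, i ≠ j ∧
      (r i, Quotient.mk (N.wordSetoid n z) (x.drop i ++ [N.bot])) =
        (r j, Quotient.mk (N.wordSetoid n z) (x.drop j ++ [N.bot])) := by
    by_contra! hc
    have hinj : Function.Injective fun i : Fin (N.boundTopWord n z) =>
        (r i, Quotient.mk (N.wordSetoid n z) (x.drop i ++ [N.bot])) := by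
      intro i j h
      by_contra hne
      exact hc i j hne h
    have := Nat.card_le_card_of_injective _ hinj
    rw [Nat.card_prod, Nat.card_fin] at this
    exact absurd this (Nat.not_succ_le_self _)
  wlog hij : i < j generalizing i j
  · exact this j i hne.symm he.symm (lt_of_le_of_ne (not_lt.1 hij) hne.symm)
  obtain ⟨h1, h2⟩ := Prod.mk.inj he
  have h2 : N.WordEquiv n z (x.drop i ++ [N.bot]) (x.drop j ++ [N.bot]) := Quotient.exact h2
  have h3 := h2.ladder hz (by simp) (hr₂ i)
  rw [h1] at h3
  refine ⟨x.take i ++ x.drop j, (hr₁ j).trans h3, ?_, ?_, ?_⟩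
  · rw [List.length_append, List.length_take, List.length_drop]
    omega
  · rw [List.length_append, List.length_take, List.length_drop]
    omega
  · have := h2.append hz (by simp) (x.take i)
    rwa [← List.append_assoc, ← List.append_assoc, List.take_append_drop] at this

/-- The part of a run to `y ++ u :: t` after its last visit to `u :: t` does not depend on `t`. -/
theorem Good.exists_suffix {N : PDS₂ Q A} {u : List A} {t : List (List A)} :
    ∀ {y : List (List A)} {q : Q}, N.Good q (y ++ u :: t) →
      ∃ p, N.Good p (u :: t) ∧ ∀ t', N.Good p (u :: t') → N.Good q (y ++ u :: t')
  | [], q, h => ⟨q, h, fun _ h => h⟩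
  | [w], q, h => by
    obtain ⟨p, -, h1, -, -, h2⟩ := h.exists_clone
    exact ⟨p, h1, h2⟩
  | w :: u' :: y, q, h => by
    obtain ⟨p, -, h1, -, -, h2⟩ := h.exists_clone (w := w) (u := u') (t := y ++ u :: t)
    obtain ⟨p', h3, h4⟩ := Good.exists_suffix (y := u' :: y) h1
    exact ⟨p', h3, fun t' h => h2 _ (h4 t' h)⟩

theorem stackHeight_le_iff {s : List (List A)} {b : ℕ} :
    stackHeight s ≤ b ↔ ∀ u ∈ s, u.length ≤ b := by
  induction s with
  | nil => simp [stackHeight]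
  | cons w s ih =>
    simp only [stackHeight, List.map_cons, List.foldr_cons, max_le_iff] at ih ⊢
    rw [ih]
    simp

/-- A stack that is wider than the number of pairs of a state and a word of at most its height has
two equal words that have last been topmost in the same state; the part between them can be left
out. -/
theorem Good.exists_narrower [Finite Q] [Finite A] {N : PDS₂ Q A} {q : Q} {s : List (List A)}
    (hs : N.Good q s) (hw : N.boundWidth (stackHeight s) < stackWidth s) :
    ∃ s', N.Good q s' ∧ topWord s' = topWord s ∧ s'.length < s.length ∧ ∀ u ∈ s', u ∈ s := by
  have hsp : ∀ i : Fin s.length, s = s.take i ++ s[i] :: s.drop (i + 1) := fun i => by simp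
  have hd : ∀ i : Fin s.length, ∃ p, N.Good p (s[i] :: s.drop (i + 1)) ∧
      ∀ t', N.Good p (s[i] :: t') → N.Good q (s.take i ++ s[i] :: t') := fun i =>
    Good.exists_suffix (by rwa [← hsp i])
  choose p hp₁ hp₂ using hd
  have hlen : ∀ i : Fin s.length, s[i].length ≤ stackHeight s := fun i =>
    stackHeight_le_iff.1 le_rfl _ (List.getElem_mem i.2)
  obtain ⟨i, j, hne, h1, h2⟩ : ∃ i j, i ≠ j ∧ p i = p j ∧ s[i] = s[j] := by
    by_contra! hc
    -- words of length at most `h` are coded by functions on `Fin h`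
    have hinj : Function.Injective fun i : Fin s.length =>
        (p i, fun k : Fin (stackHeight s) => s[i][(k : ℕ)]?) := by
      intro i j h
      by_contra hne
      obtain ⟨h1, h2⟩ := Prod.mk.inj h
      refine hc i j hne h1 (List.ext_getElem? fun k => ?_)
      by_cases hk : k < stackHeight s
      · exact congrFun h2 ⟨k, hk⟩
      · rw [List.getElem?_eq_none ((hlen i).trans (not_lt.1 hk)),
          List.getElem?_eq_none ((hlen j).trans (not_lt.1 hk))]
    have := Nat.card_le_card_of_injective _ hinj
    rw [Nat.card_prod, Nat.card_fin, Nat.card_fun, Nat.card_fin, Finite.card_option] at this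
    exact absurd hw (not_lt.2 this)
  wlog hij : i < j generalizing i j
  · exact this j i hne.symm h1.symm h2.symm (lt_of_le_of_ne (not_lt.1 hij) hne.symm)
  refine ⟨s.take i ++ s[i] :: s.drop (j + 1), hp₂ i _ ?_, ?_, ?_, ?_⟩
  · rw [h1, h2]
    exact hp₁ j
  · conv_rhs => rw [hsp i]
    cases s.take i <;> rfl
  · rw [List.length_append, List.length_take, List.length_cons, List.length_drop]
    omega
  · intro u hu
    rcases List.mem_append.1 hu with hu | hu
    · exact List.mem_of_mem_take hu
    · rcases List.mem_cons.1 hu with rfl | hu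
      · exact List.getElem_mem i.2
      · exact List.mem_of_mem_drop hu

theorem Good.exists_boundWidth [Finite Q] [Finite A] {N : PDS₂ Q A} {q : Q} {s : List (List A)}
    (hs : N.Good q s) : ∃ s', N.Good q s' ∧ topWord s' = topWord s ∧ (∀ u ∈ s', u ∈ s) ∧
      stackWidth s' ≤ N.boundWidth (stackHeight s') := by
  induction hn : s.length using Nat.strong_induction_on generalizing s with
  | _ n ih =>
    by_cases hw : stackWidth s ≤ N.boundWidth (stackHeight s)
    · exact ⟨s, hs, rfl, fun u hu => hu, hw⟩
    · obtain ⟨s', h1, h2, h3, h4⟩ := hs.exists_narrower (not_le.1 hw)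
      obtain ⟨s'', g1, g2, g3, g4⟩ := ih _ (hn ▸ h3) h1 rfl
      exact ⟨s'', g1, g2.trans h2, fun u hu => h4 u (g3 u hu), g4⟩

end PDS₂

theorem mainTheorem6 {Q : Type u} {A : Type v} [Finite Q] [Finite A] (N : PDS₂ Q A)
    (n z : ℕ) (hz : 2 ≤ z) (ρ : List (Q × List (List A))) (q : Q) (s : List (List A))
    (hρ : N.IsRun ρ N.initConf (q, s)) :
    Finite (N.WordClasses n z) ∧ Finite (N.WordClasses 0 2) ∧
    ∃ (ρ' : List (Q × List (List A))) (q' : Q) (s' : List (List A)),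
      N.IsRun ρ' N.initConf (q', s') ∧
      (topWord s).length ≤ (topWord s').length + N.boundTopWord n z ∧
      (topWord s').length ≤ (topWord s).length ∧
      stackHeight s' ≤ (topWord s').length + N.boundHeight ∧
      stackWidth s' ≤ N.boundWidth (stackHeight s') ∧
      N.WordEquiv n z (topWord s) (topWord s') ∧
      (N.boundTopWord n z < (topWord s).length →
        (topWord s').length < (topWord s).length) := by
  refine ⟨N.finite_wordClasses n z, N.finite_wordClasses 0 2, ?_⟩
  obtain ⟨x, hx, hl⟩ := ((N.good_iff q s).2 ⟨ρ, hρ⟩).exists_ladder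
  obtain ⟨x', hl', h1, h2, h3, h4⟩ : ∃ x', N.Ladder [N.bot] N.init q x' ∧
      x.length ≤ x'.length + N.boundTopWord n z ∧ x'.length ≤ x.length ∧
      N.WordEquiv n z (x ++ [N.bot]) (x' ++ [N.bot]) ∧
      (N.boundTopWord n z < (x ++ [N.bot]).length → x'.length < x.length) := by
    by_cases hc : N.boundTopWord n z < (x ++ [N.bot]).length
    · obtain ⟨x', h1, h2, h3, h4⟩ := hl.exists_shorter hz hc
      exact ⟨x', h1, h3, h2.le, h4, fun _ => h2⟩
    · exact ⟨x, hl, by omega, le_rfl, rfl, fun h => absurd h hc⟩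
  obtain ⟨t, hg, ht⟩ := hl'.good
  obtain ⟨s', hg', htop, hsub, hw⟩ := hg.exists_boundWidth
  obtain ⟨ρ', hρ'⟩ := (N.good_iff q s').1 hg'
  have htop' : topWord s' = x' ++ [N.bot] := htop
  have hlen : ∀ y : List A, (y ++ [N.bot]).length = y.length + 1 := fun y => by simp
  refine ⟨ρ', q, s', hρ', ?_, ?_, ?_, hw, ?_, ?_⟩ <;> rw [htop'] <;> try rw [hx]
  · rw [hlen, hlen]
    omega
  · rw [hlen, hlen]
    omega
  · refine PDS₂.stackHeight_le_iff.2 fun u hu => ?_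
    rcases List.mem_cons.1 (hsub u hu) with rfl | hu
    · exact Nat.le_add_right _ _
    · exact ht u hu
  · exact h3
  · intro h
    have := h4 h
    rw [hlen, hlen]
    omega
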